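/- Let $M,\bar M$ be complete $n$-dimensional (smooth, second countable) Riemannian manifolds and let $c:M\times\bar M\to\mathbb R$ be semiconcave in each variable, i.e. locally, in charts, $c(\cdot,\bar x)$ and $c(x,\cdot)$ are sums of a concave and a smooth function. Write $\bar M(x)$ for the set of $\bar x\in\bar M$ such that $c$ is smooth in a neighbourhood of $(x,\bar x)$, $M(\bar x)$ for the set of $x \in M$ with the same property, $M^*(x)=-D_xc(x,\bar M(x))\subset T^*_xM$ and $\bar M^*(\bar x)=-D_{\bar x}c(M(\bar x),\bar x)\subset T^*_{\bar x}\bar M$. Assume that, for all $x\in M$ and $\bar x\in\bar M$: 1. (twist) $-D_xc(x,\cdot):\bar M(x)\to T_x^*M$ and $-D_{\bar x}c(\cdot,\bar x):M(\bar x)\to T^*_{\bar x}\bar M$ are smooth embeddings. Denote by $c\text{-Exp}_x:M^*(x)\to\bar M$ and $\bar c\text{-Exp}_{\bar x}:\bar M^*(\bar x)\to M$ the inverse maps. 2. ($c$-Exp extension) $c\text{-Exp}_x$ extends to a smooth map (denoted in the same way) from $\mathrm{cl}(M^*(x))$ onto $\bar M$, and for every $p\in \mathrm{cl}(M^*(x))$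 one has $c\text{-Exp}_x\,p\in c\text{-Exp}_x\big(\partial_x(-c(\cdot,c\text{-Exp}_x\,p))(x)\cap \mathrm{cl}(M^*(x))\big)$. Here $\partial\alpha(x)$ is the set of the covectors $p\in T^*_xM$ with $\alpha(\exp_x v)-\alpha(x)\ge\langle p,v\rangle+o(|v|)$ as $v\to0$. The same holds for $\bar c\text{-Exp}_{\bar x}$ on $\mathrm{cl}(\bar M^*(\bar x))$, with the two variables exchanged. 3. (convex domains) $M^*(x)$ and $\bar M^*(\bar x)$ are convex. 4. (convex DASM) If $\bar x(t)=c\text{-Exp}_x((1-t)p_0+tp_1)$, $0\le t\le1$, is the image of a line segment in $\mathrm{cl}(M^*(x))$, then $m_t:=-c(\cdot,\bar x(t))+c(x,\bar x(t))$ satisfies $m_t\le(1-t)m_0+tm_1$ on $M$ for $0\le t\le 1$. If $x(t)=\bar c\text{-Exp}_{\bar x}((1-t)\bar p_0+t\bar p_1)$, $0\le t\le 1$, is the image of a line segment in $\mathrm{cl}(\bar M^*(\bar x))$, then $\bar m_t:=-c(x(t),\cdot)+c(x(t),\bar x)$ satisfies $\bar m_t\le(1-t)\bar m_0+t\bar m_1$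 on $\bar M$ for $0\le t\le 1$. Let $\phi:M\to\mathbb R$ be $c$-convex, i.e. there is $\bar\phi:\bar M\to\mathbb R$ with $\phi(x)=\sup_{\bar x\in\bar M}\{-c(x,\bar x)-\bar\phi(\bar x)\}$ for all $x$ and $\bar\phi(\bar x)=\sup_{x\in M}\{-c(x,\bar x)-\phi(x)\}$ for all $\bar x$. Put $\partial^c\phi(x)=\{\bar x\in\bar M:\ \phi(y)-\phi(x)\ge-c(y,\bar x)+c(x,\bar x)\ \forall y\in M\}$ and $\partial^c\phi(\Omega)=\bigcup_{x\in\Omega}\partial^c\phi(x)$. With $|\cdot|$ the Riemannian volume, assume that for some $\lambda>0$ one has $\lambda|\Omega|\le|\partial^c\phi(\Omega)|$ for all Borel sets $\Omega\subset M$. Let $\bar x_0\in\partial^c\phi(x_0)$ and $h>0$, and suppose that the $c$-section $$Z_h:=\{x\in M:\ \phi(x)-\phi(x_0)\le-c(x,\bar x_0)+c(x_0,\bar x_0)+h\}$$ is contained in $M(\bar x_0)$. Then $$\lambda|Z_h|^2\le(4n)^n|B_1|^2\left[\frac{\sup_{x\in Z_h}|\det(-D_xD_{\bar x}c(x,\bar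 x_0))|}{\inf_{x\in Z_h}|\det(-D_xD_{\bar x}c(x,\bar x_0))|}\right]^2\Big[\sup_{x\in Z_h}\ \sup_{p\in M^*(x)}|\det (d\,c\text{-Exp}_x|_p)|\Big]\,h^n .$$ Here $|B_1|$ is the Lebesgue measure of the unit ball of $\mathbb R^n$, determinants are taken with respect to orthonormal bases (and their dual bases) of the tangent and cotangent spaces, and the inequality holds in $[0,\infty]$, with $0^0=1$ (for $n=0$) and with quotients equal to $\infty$ if the infimum is $0$ or the supremum is $\infty$. -/

import Mathlib

open Set Filter Topology MeasureTheory Bundle Manifold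
open scoped ENNReal ContDiff

noncomputable section

namespace OT

/-- The cotangent space `T*_x M` of an `n`-dimensional manifold, with the dual norm of the
Riemannian metric whenever `M` carries one. -/
abbrev Cotangent (n : ℕ) {M : Type*} [TopologicalSpace M]
    [ChartedSpace (EuclideanSpace ℝ (Fin n)) M] (x : M) : Type :=
  TangentSpace (𝓡 n) x →L[ℝ] ℝ

section Riemannian

variable (n : ℕ) {M : Type*} [TopologicalSpace M] [ChartedSpace (EuclideanSpace ℝ (Fin n)) M]

instance instFiniteDimensionalTangent (x : M) : FiniteDimensional ℝ (TangentSpace (𝓡 n) x) :=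
  inferInstanceAs (FiniteDimensional ℝ (EuclideanSpace ℝ (Fin n)))

theorem finrank_tangent (x : M) : Module.finrank ℝ (TangentSpace (𝓡 n) x) = n :=
  finrank_euclideanSpace_fin (𝕜 := ℝ) (n := n)

variable [RiemannianBundle (fun x : M => TangentSpace (𝓡 n) x)]

/-- Some orthonormal basis of `T_x M` for the Riemannian metric. It is used only inside absolute
values of determinants, which do not depend on the choice. -/
def orthoFrame (x : M) : OrthonormalBasis (Fin n) ℝ (TangentSpace (𝓡 n) x) :=
  (stdOrthonormalBasis ℝ (TangentSpace (𝓡 n) x)).reindex (finCongr (finrank_tangent n x))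

/-- The coordinate vector field `∂_i` of the chart around `z`, at the point with coordinates `u`. -/
def coordVec (z : M) (u : EuclideanSpace ℝ (Fin n)) (i : Fin n) :
    TangentSpace (𝓡 n) ((extChartAt (𝓡 n) z).symm u) :=
  mfderiv 𝓘(ℝ, EuclideanSpace ℝ (Fin n)) (𝓡 n) (extChartAt (𝓡 n) z).symm u
    (EuclideanSpace.single i (1 : ℝ) : EuclideanSpace ℝ (Fin n))

/-- The Riemannian volume density `√ det (g_ij)` in the chart around `z`. -/
def volDensity (z : M) (u : EuclideanSpace ℝ (Fin n)) : ℝ :=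
  √ (Matrix.of fun i j : Fin n => inner ℝ (coordVec n z u i) (coordVec n z u j)).det

/-- The measure `√ det (g_ij) du` on the domain of the chart around `z`, seen as a measure on `M`
that vanishes outside that domain. -/
def chartVol [MeasurableSpace M] (z : M) : Measure M :=
  (((volume : Measure (EuclideanSpace ℝ (Fin n))).restrict
      (extChartAt (𝓡 n) z).target).withDensity
    fun u => ENNReal.ofReal (volDensity n z u)).map (extChartAt (𝓡 n) z).symm

/-- The Riemannian volume measure. The measures `√ det (g_ij) du` of two charts agree on the
intersection of their domains, and the volume is the measure that they glue to, which is the least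
measure that dominates all of them. -/
def riemVol [MeasurableSpace M] : Measure M := ⨆ z : M, chartVol n z

end Riemannian

section Cost

/- `M` is the source and `N` the target of the transport. Every notion is written for the first
variable of the cost; the notion for the second variable is the same one for the reversed cost
`flip c : N → M → ℝ`. -/
variable (n : ℕ) {M N : Type*}
  [TopologicalSpace M] [ChartedSpace (EuclideanSpace ℝ (Fin n)) M]
  [TopologicalSpace N] [ChartedSpace (EuclideanSpace ℝ (Fin n)) N]

/-- `c` is smooth in a neighbourhood of `(x, y)`. -/
def SmoothNear (c : M → N → ℝ) (x : M) (y : N) : Prop :=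
  ∃ U ∈ 𝓝 (x, y), ContMDiffOn ((𝓡 n).prod (𝓡 n)) 𝓘(ℝ, ℝ) ∞ (Function.uncurry c) U

/-- For `x : M`, the set of the points of `N` that are not in the cut locus of `x` with respect
to the cost (the injectivity locus). -/
def injLocus (c : M → N → ℝ) (x : M) : Set N := {y | SmoothNear n c x y}

/-- The covector `-D_x c (x, y) ∈ T*_x M`. -/
def negD (c : M → N → ℝ) (x : M) (y : N) : Cotangent n x :=
  -((NormedSpace.fromTangentSpace (c x y)).toContinuousLinearMap ∘L
    mfderiv (𝓡 n) 𝓘(ℝ, ℝ) (fun x' => c x' y) x)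

/-- The domain `M*(x) = -D_x c (x, N(x)) ⊆ T*_x M` of the `c`-exponential at `x`. -/
def expDomain (c : M → N → ℝ) (x : M) : Set (Cotangent n x) := negD n c x '' injLocus n c x

/-- A local form of semiconcavity in the first variable: for every `y`, near every point `c (·, y)`
is in a chart the sum of a concave function and of a smooth function. -/
def SemiconcaveFst (c : M → N → ℝ) : Prop :=
  ∀ (y : N) (x : M), ∃ U : Set (EuclideanSpace ℝ (Fin n)),
    IsOpen U ∧ Convex ℝ U ∧ extChartAt (𝓡 n) x x ∈ U ∧ U ⊆ (extChartAt (𝓡 n) x).target ∧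
    ∃ s : EuclideanSpace ℝ (Fin n) → ℝ, ContDiffOn ℝ ∞ s U ∧
      ConcaveOn ℝ U fun u => c ((extChartAt (𝓡 n) x).symm u) y - s u

variable [RiemannianBundle (fun x : M => TangentSpace (𝓡 n) x)]

/-- Twist in the first variable: `-D_x c (x, ·)` is a smooth embedding of the injectivity locus
into `T*_x M`. -/
def TwistFst (c : M → N → ℝ) : Prop :=
  ∀ x : M, ContMDiffOn (𝓡 n) 𝓘(ℝ, Cotangent n x) ∞ (negD n c x) (injLocus n c x) ∧
    (∀ y ∈ injLocus n c x,
      Function.Injective (mfderiv (𝓡 n) 𝓘(ℝ, Cotangent n x) (negD n c x) y)) ∧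
    IsEmbedding ((injLocus n c x).domRestrict (negD n c x))

/-- The `c`-exponential at `x`: the inverse of `-D_x c (x, ·)` on `M*(x)`, extended by continuity
to the closure of `M*(x)`. -/
def cExp [Nonempty N] (c : M → N → ℝ) (x : M) : Cotangent n x → N :=
  extendFrom (expDomain n c x) (Function.invFunOn (negD n c x) (injLocus n c x))

/-- The subdifferential at `x`, i.e. the covectors `p` such that
`α (exp_x v) - α x ≥ ⟨p, v⟩ + o(|v|)` as `v → 0` in `T_x M`. In place of `v ↦ exp_x v` stands
`v ↦ φ⁻¹ (φ x + v)` for the preferred chart `φ` at `x`, which is how Mathlib identifies `T_x M`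
with the model space; the two maps have value `x` and differential `id` at `v = 0`, so that they
define the same set of covectors. -/
def subdiff (α : M → ℝ) (x : M) : Set (Cotangent n x) :=
  {p | ∀ ε > (0 : ℝ), ∀ᶠ v : TangentSpace (𝓡 n) x in 𝓝 0,
    p v - ε * ‖v‖ ≤
      α ((extChartAt (𝓡 n) x).symm
        (extChartAt (𝓡 n) x x + (show EuclideanSpace ℝ (Fin n) from v))) - α x}

/-- The `c`-exponential extends to a smooth map from the closure of `M*(x)` onto `N`, and for every
`p` in this closure the point `cExp p` is again the image under the extended map of a covector in
the subdifferential at `x` of `-c (·, cExp p)`. -/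
def CExpExtendsFst [Nonempty N] (c : M → N → ℝ) : Prop :=
  ∀ x : M,
    ContMDiffOn 𝓘(ℝ, Cotangent n x) (𝓡 n) ∞ (cExp n c x) (closure (expDomain n c x)) ∧
    cExp n c x '' closure (expDomain n c x) = univ ∧
    ∀ p ∈ closure (expDomain n c x),
      cExp n c x p ∈ cExp n c x ''
        (subdiff n (fun x' => -c x' (cExp n c x p)) x ∩ closure (expDomain n c x))

/-- The domains `M*(x)` are convex. -/
def ConvexDomainsFst (c : M → N → ℝ) : Prop := ∀ x : M, Convex ℝ (expDomain n c x)

/-- `γ` restricted to `[0, 1]` is a `c`-segment with respect to `x`: the image under the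
`c`-exponential of a line segment in the closure of `M*(x)`. -/
def IsCSegment [Nonempty N] (c : M → N → ℝ) (x : M) (γ : ℝ → N) : Prop :=
  ∃ p₀ p₁ : Cotangent n x, ∀ t ∈ Icc (0 : ℝ) 1,
    (1 - t) • p₀ + t • p₁ ∈ closure (expDomain n c x) ∧ γ t = cExp n c x ((1 - t) • p₀ + t • p₁)

/-- Convex DASM along `c`-segments in `N`: the functions `m_t = -c (·, γ t) + c (x, γ t)` satisfy
`m_t ≤ (1 - t) m_0 + t m_1`. -/
def ConvexDASMFst [Nonempty N] (c : M → N → ℝ) : Prop :=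
  ∀ (x : M) (γ : ℝ → N), IsCSegment n c x γ → ∀ t ∈ Icc (0 : ℝ) 1, ∀ x' : M,
    -c x' (γ t) + c x (γ t) ≤
      (1 - t) * (-c x' (γ 0) + c x (γ 0)) + t * (-c x' (γ 1) + c x (γ 1))

variable [RiemannianBundle (fun y : N => TangentSpace (𝓡 n) y)]

/-- `c` is semiconcave in both variables. -/
def Semiconcave (c : M → N → ℝ) : Prop := SemiconcaveFst n c ∧ SemiconcaveFst n (flip c)

/-- The twist condition. -/
def Twist (c : M → N → ℝ) : Prop := TwistFst n c ∧ TwistFst n (flip c)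

/-- Smooth extension of both `c`-exponentials. -/
def CExpExtends [Nonempty M] [Nonempty N] (c : M → N → ℝ) : Prop :=
  CExpExtendsFst n c ∧ CExpExtendsFst n (flip c)

/-- Convexity of the domains of both `c`-exponentials. -/
def ConvexDomains (c : M → N → ℝ) : Prop := ConvexDomainsFst n c ∧ ConvexDomainsFst n (flip c)

/-- The convex "Double Mountain Above Sliding Mountain" property, in both variables. -/
def ConvexDASM [Nonempty M] [Nonempty N] (c : M → N → ℝ) : Prop :=
  ConvexDASMFst n c ∧ ConvexDASMFst n (flip c)

/-- `|det (-D_x D_y c (x, y))|`, the absolute determinant, in orthonormal bases of `T_x M` and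
`T_y N`, of the derivative at `x` of the map `x' ↦ -D_y c (x', y) ∈ T*_y N`. -/
def absDetMixed (c : M → N → ℝ) (x : M) (y : N) : ℝ :=
  |(Matrix.of fun i j : Fin n =>
    ((NormedSpace.fromTangentSpace (negD n (flip c) y x)).toContinuousLinearMap ∘L
      mfderiv (𝓡 n) 𝓘(ℝ, Cotangent n y) (fun x' => negD n (flip c) y x') x)
      (orthoFrame n x i) (orthoFrame n y j)).det|

/-- `|det (d cExp_x)|` at `p`, the Jacobian of the `c`-exponential at `p`: the absolute determinant
of its differential with respect to the basis of `T*_x M` that is dual to an orthonormal basis of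
`T_x M` and to an orthonormal basis of the tangent space of `N`. -/
def absDetCExp [Nonempty N] (c : M → N → ℝ) (x : M) (p : Cotangent n x) : ℝ :=
  |(Matrix.of fun i j : Fin n =>
    inner ℝ (orthoFrame n (cExp n c x p) i)
      (mfderiv 𝓘(ℝ, Cotangent n x) (𝓡 n) (cExp n c x) p
        ((NormedSpace.fromTangentSpace p).symm (innerSL ℝ (orthoFrame n x j))))).det|

end Cost

section CConvex

variable {M N : Type*}

/-- `φ` is `c`-convex: it has a dual function `ψ : N → ℝ`, and each of the two functions is the
`c`-transform of the other one. -/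
def CConvex (c : M → N → ℝ) (φ : M → ℝ) : Prop :=
  ∃ ψ : N → ℝ, (∀ x, IsLUB (range fun y => -c x y - ψ y) (φ x)) ∧
    ∀ y, IsLUB (range fun x => -c x y - φ x) (ψ y)

/-- The `c`-subdifferential of `φ` at `x`. -/
def cSubdiff (c : M → N → ℝ) (φ : M → ℝ) (x : M) : Set N :=
  {y | ∀ x' : M, -c x' y + c x y ≤ φ x' - φ x}

/-- The image `∂^c φ (Ω)` of a set under the `c`-subdifferential. -/
def cSubdiffImage (c : M → N → ℝ) (φ : M → ℝ) (Ω : Set M) : Set N := ⋃ x ∈ Ω, cSubdiff c φ x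

/-- The `c`-section of `φ` of height `h` at `x₀` with respect to `y₀`. -/
def cSection (c : M → N → ℝ) (φ : M → ℝ) (x₀ : M) (y₀ : N) (h : ℝ) : Set M :=
  {x | φ x - φ x₀ ≤ -c x y₀ + c x₀ y₀ + h}

end CConvex

end OT

end

set_option linter.unusedSectionVars false

noncomputable section

namespace OT

/-! ### A weak Santaló inequality from simplices of maximal volume. -/

section ConvexGeometry

open Matrix Real

/-! The reversed `c`-exponential `X` at `y₀` serves as a chart of `injLocus n (flip c) y₀`. By the
DASM property each function `-c (·, y) + c (·, y₀)` is convex in this chart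
(`convexOn_slidingCost`), hence so is `φ + c (·, y₀)` (`CConvex.convexOn`). The latter is minimal at
`x₀`, and the section is its sublevel set at height `h` above the minimum. So the section
corresponds to a convex set `W` of covectors, and an Aleksandrov-type estimate can be run there.

Let `K ⊆ W` be compact and convex, `z ∈ K`, and let `K'` be the copy of `K` shrunk by `1/2` towards
`z`. If `y` is a `c`-subgradient of `φ` at a point of `X '' K'`, then on `K` the function `-c (·, y)
+ c (·, y₀)` exceeds its value at `z` by at most `2h`. The extension hypothesis writes `y` as the
`c`-exponential at `X z` of a covector in the subdifferential of `-c (·, y)`. Convexity makes this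
local subgradient global, so that, after a shift and a pullback by the differential of `X`, it lies
in `2h` times the polar body of `K - z` (`cSubdiffImage_subset`).

The differential of `X` is inverse to the mixed derivative of the cost
(`absDetMixed_mul_absDetCExp`). With `S` and `D` the suprema of the mixed determinant and of the
Jacobian of the `c`-exponential, comparing volumes gives `λ|K'| ≤ S² D (2h)^n P`, where `P` is the
volume of the polar body. Now multiply by `|K| = 2^n |K'|` and bound `|K| P`. The sharp
Blaschke-Santaló inequality is not needed: for the centroid `z` of a simplex of maximal volume in
`K` one has `|K| P ≤ n^n |B₁|²` (`exists_volume_mul_volume_polar_le`), and `2^n · 2^n · n^n =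
(4n)^n`. Finally `W` is exhausted by compact convex sets, and the return from `W` to the section
costs the squared inverse of the infimum of the mixed determinant. -/

theorem add_two_pow_le (m : ℕ) (hm : 1 ≤ m) :
    ((m : ℝ) + 2) ^ (m + 2) ≤ 4 * π ^ 2 * (m : ℝ) ^ (m + 2) := by
  -- For `m ≥ 2` the factors `(1 + 2/m)^m ≤ e² ≤ 7.4` and `(1 + 2/m)² ≤ 4` leave room below `39`;
  -- for `m = 1` the claim is `27 ≤ 39`.
  have hpi : (39 : ℝ) ≤ 4 * π ^ 2 := by nlinarith [Real.pi_gt_d2]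
  have hm0 : (0 : ℝ) < m := by exact_mod_cast hm
  refine le_trans ?_ (mul_le_mul_of_nonneg_right hpi (by positivity))
  rcases eq_or_lt_of_le hm with rfl | h2
  · norm_num
  have h2' : (2 : ℝ) ≤ m := by exact_mod_cast h2
  have e1 : ((m : ℝ) + 2) ^ m ≤ 7.4 * (m : ℝ) ^ m := by
    have h1 : 1 + 2 / (m : ℝ) ≤ Real.exp (2 / m) := by
      have := Real.add_one_le_exp (2 / (m : ℝ)); linarith
    have h3 : (1 + 2 / (m : ℝ)) ^ m ≤ Real.exp 2 := by
      calc (1 + 2 / (m : ℝ)) ^ m ≤ Real.exp (2 / m) ^ m := by gcongr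
        _ = Real.exp 2 := by rw [← Real.exp_nat_mul]; congr 1; field_simp
    have h4 : Real.exp 2 ≤ 7.4 := by
      have : Real.exp 2 = Real.exp 1 ^ 2 := by rw [← Real.exp_nat_mul]; norm_num
      rw [this]; nlinarith [Real.exp_one_lt_d9, Real.exp_pos 1]
    have h5 : ((m : ℝ) + 2) = (1 + 2 / m) * m := by field_simp
    rw [h5, mul_pow]
    exact mul_le_mul_of_nonneg_right (h3.trans h4) (by positivity)
  have e2 : ((m : ℝ) + 2) ^ 2 ≤ 4 * (m : ℝ) ^ 2 := by nlinarith
  calc ((m : ℝ) + 2) ^ (m + 2) = ((m : ℝ) + 2) ^ m * ((m : ℝ) + 2) ^ 2 := pow_add _ _ _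
    _ ≤ (7.4 * (m : ℝ) ^ m) * (4 * (m : ℝ) ^ 2) := by gcongr
    _ = 29.6 * (m : ℝ) ^ (m + 2) := by ring
    _ ≤ 39 * (m : ℝ) ^ (m + 2) := by gcongr; norm_num

/-- The Blaschke-Santaló inequality for the simplex, in explicit form. -/
theorem simplex_santalo (n : ℕ) :
    ((n : ℝ) + 1) ^ (n + 1) * Gamma (n / 2 + 1) ^ 2 ≤ π ^ n * (n.factorial : ℝ) ^ 2 := by
  induction n using Nat.twoStepInduction with
  | zero => simp
  | one =>
    have : Gamma ((1 : ℕ) / 2 + 1) = √π / 2 := by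
      rw [Nat.cast_one, Real.Gamma_add_one (by norm_num), Real.Gamma_one_half_eq]; ring
    rw [this, div_pow, Real.sq_sqrt Real.pi_pos.le]
    norm_num
    linarith
  | more n ih _ =>
    have hG : Gamma (((n + 2 : ℕ) : ℝ) / 2 + 1) = ((n : ℝ) / 2 + 1) * Gamma (n / 2 + 1) := by
      rw [← Real.Gamma_add_one (by positivity)]; congr 1; push_cast; ring
    have h := add_two_pow_le (n + 1) (by omega)
    have hf : ((n + 2).factorial : ℝ) = (n + 2) * ((n + 1) * n.factorial) := by
      rw [Nat.factorial_succ, Nat.factorial_succ]; push_cast; ring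
    rw [hG, hf]
    push_cast at h ⊢
    calc ((n : ℝ) + 2 + 1) ^ (n + 2 + 1) * (((n : ℝ) / 2 + 1) * Gamma (n / 2 + 1)) ^ 2
        = ((n : ℝ) + 1 + 2) ^ (n + 1 + 2) * (((n : ℝ) / 2 + 1) * Gamma (n / 2 + 1)) ^ 2 := by
          ring_nf
      _ ≤ (4 * π ^ 2 * ((n : ℝ) + 1) ^ (n + 1 + 2)) *
          (((n : ℝ) / 2 + 1) * Gamma (n / 2 + 1)) ^ 2 := by gcongr
      _ = π ^ 2 * ((n + 1) * (n + 2)) ^ 2 * (((n : ℝ) + 1) ^ (n + 1) * Gamma (n / 2 + 1) ^ 2) := by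
          ring
      _ ≤ π ^ 2 * ((n + 1) * (n + 2)) ^ 2 * (π ^ n * (n.factorial : ℝ) ^ 2) := by gcongr
      _ = _ := by ring

/-- The simplex with vertices `0` and `r • e i`. -/
def cornerSimplex (n : ℕ) (r : ℝ) : Set (Fin n → ℝ) := {s | (∀ i, 0 ≤ s i) ∧ ∑ i, s i ≤ r}

/-- Up to null sets, `2 ^ n` congruent reflected copies of the simplex fit disjointly into the `ℓ¹`
ball of radius `r`, whose volume `(2r)^n / n!` is known. -/
theorem volume_cornerSimplex_le (n : ℕ) {r : ℝ} (hr : 0 ≤ r) :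
    volume (cornerSimplex n r) ≤ ENNReal.ofReal (r ^ n / n.factorial) := by
  rcases Nat.eq_zero_or_pos n with rfl | hn
  · refine (measure_mono (subset_univ _)).trans ?_
    simp [volume_pi]
  have : Nonempty (Fin n) := ⟨⟨0, hn⟩⟩
  set T : Set (Fin n → ℝ) := {s | (∀ i, 0 < s i) ∧ ∑ i, s i ≤ r} with hT
  have hTm : MeasurableSet T := by
    have h1 : MeasurableSet {s : Fin n → ℝ | ∀ i, 0 < s i} := by
      rw [ofPred_forall]
      exact MeasurableSet.iInter fun i => measurableSet_lt measurable_const (measurable_pi_apply i)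
    have h2 : MeasurableSet {s : Fin n → ℝ | ∑ i, s i ≤ r} :=
      measurableSet_le (by fun_prop) measurable_const
    exact h1.inter h2
  -- The coordinate hyperplanes are null; without them the reflected copies are truly disjoint.
  have hae : volume (cornerSimplex n r) ≤ volume T := by
    refine measure_mono_ae ?_
    have : ∀ᵐ s : Fin n → ℝ, ∀ i, s i ≠ 0 := by
      rw [ae_all_iff]; intro i
      exact Measure.ae_eval_ne (μ := fun _ : Fin n => (volume : Measure ℝ)) i 0
    filter_upwards [this] with s hs hmem
    exact ⟨fun i => lt_of_le_of_ne (hmem.1 i) (hs i).symm, hmem.2⟩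
  -- the reflections of `T` in the coordinate hyperplanes are disjoint and lie in the `ℓ¹` ball
  let g : (Fin n → ℤˣ) → (Fin n → ℝ) → (Fin n → ℝ) := fun e s i => ((e i : ℤ) : ℝ) * s i
  have habs : ∀ u : ℤˣ, |((u : ℤ) : ℝ)| = 1 := fun u => by
    rcases Int.units_eq_one_or u with rfl | rfl <;> simp
  have hsq : ∀ u : ℤˣ, ((u : ℤ) : ℝ) * ((u : ℤ) : ℝ) = 1 := fun u => by
    rcases Int.units_eq_one_or u with rfl | rfl <;> simp
  have hvol : ∀ e, volume (g e ⁻¹' T) = volume T := by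
    intro e
    have hg : g e = Matrix.toLin' (Matrix.diagonal fun i => ((e i : ℤ) : ℝ)) := by
      ext s i; simp [g, Matrix.mulVec_diagonal]
    have hdet : |LinearMap.det (Matrix.toLin' (Matrix.diagonal fun i => ((e i : ℤ) : ℝ)))| = 1 := by
      rw [LinearMap.det_toLin', Matrix.det_diagonal, Finset.abs_prod]
      exact Finset.prod_eq_one fun i _ => habs _
    rw [hg, Measure.addHaar_preimage_linearMap _ (by intro h0; rw [h0] at hdet; simp at hdet),
      abs_inv, hdet]
    simp
  have hgm : ∀ e, Measurable (g e) := fun e => by fun_prop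
  have hdisj : Pairwise (Function.onFun Disjoint fun e => g e ⁻¹' T) := by
    intro e e' hne
    refine Set.disjoint_left.2 fun s hs hs' => hne ?_
    ext i
    have h1 := hs.1 i
    have h2 := hs'.1 i
    simp only [g] at h1 h2
    rcases Int.units_eq_one_or (e i) with h | h <;> rcases Int.units_eq_one_or (e' i) with h' | h' <;>
      simp [h, h'] at h1 h2 ⊢ <;> linarith
  have hsub : (⋃ e, g e ⁻¹' T) ⊆ {x : Fin n → ℝ | (∑ i, |x i| ^ (1 : ℝ)) ^ (1 / (1 : ℝ)) ≤ r} := by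
    intro s hs
    obtain ⟨e, he⟩ := mem_iUnion.1 hs
    simp only [mem_ofPred_eq, rpow_one, div_one]
    refine le_trans (le_of_eq ?_) he.2
    refine Finset.sum_congr rfl fun i _ => ?_
    have := he.1 i
    rw [← abs_of_pos this]
    simp only [g, abs_mul, habs, one_mul]
  have key : (2 : ℝ≥0∞) ^ n * volume T ≤ ENNReal.ofReal r ^ n * ENNReal.ofReal (2 ^ n / n.factorial) := by
    calc (2 : ℝ≥0∞) ^ n * volume T = ∑ e : Fin n → ℤˣ, volume (g e ⁻¹' T) := by
          simp [hvol]
      _ = volume (⋃ e, g e ⁻¹' T) := by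
          rw [measure_iUnion hdisj fun e => hgm e hTm, tsum_fintype]
      _ ≤ _ := measure_mono hsub
      _ = _ := by
          rw [MeasureTheory.volume_sum_rpow_le (Fin n) le_rfl r]
          simp only [Fintype.card_fin, div_one]
          rw [Real.Gamma_nat_eq_factorial]
          have : Real.Gamma (1 + 1) = 1 := by simpa using Real.Gamma_nat_eq_factorial 1
          rw [this, mul_one]
  refine hae.trans ?_
  have h2 : (2 : ℝ≥0∞) ^ n ≠ 0 := by simp
  have h2' : (2 : ℝ≥0∞) ^ n ≠ ⊤ := by simp
  rw [← ENNReal.mul_le_mul_iff_right h2 h2']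
  refine key.trans (le_of_eq ?_)
  rw [← ENNReal.ofReal_pow hr, ← ENNReal.ofReal_mul (by positivity),
    show (2 : ℝ≥0∞) ^ n = ENNReal.ofReal (2 ^ n) by rw [ENNReal.ofReal_pow] <;> simp,
    ← ENNReal.ofReal_mul (by positivity)]
  congr 1; ring

theorem exists_det_ne_zero_of_interior_nonempty {n : ℕ} {K : Set (Fin n → ℝ)}
    (hK : (interior K).Nonempty) : ∃ v₀ ∈ K, ∃ v : Fin n → Fin n → ℝ, (∀ i, v i ∈ K) ∧
      (Matrix.of fun i => v i - v₀).det ≠ 0 := by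
  obtain ⟨z, hz⟩ := hK
  obtain ⟨r, hr, hball⟩ := Metric.isOpen_iff.1 isOpen_interior z hz
  have hsub := hball.trans interior_subset
  refine ⟨z, hsub (Metric.mem_ball_self hr), fun i => z + Pi.single i (r / 2), fun i => hsub ?_, ?_⟩
  · rw [Metric.mem_ball, dist_eq_norm, add_sub_cancel_left, Pi.norm_single, Real.norm_eq_abs,
      abs_of_pos (by positivity)]
    linarith
  · have : (Matrix.of fun i => z + Pi.single i (r / 2) - z) =
        Matrix.diagonal fun _ : Fin n => r / 2 := by
      ext i j
      simp only [add_sub_cancel_left, Matrix.of_apply, Matrix.diagonal_apply, Pi.single_apply]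
      simp only [eq_comm]
    rw [this, Matrix.det_diagonal]
    exact Finset.prod_ne_zero_iff.2 fun _ _ => by positivity

/-- The vertices of a simplex of maximal volume in `K`: the barycentric coordinates of the points
of `K` are at most one. -/
theorem exists_maximal_simplex {n : ℕ} {K : Set (Fin n → ℝ)} (hK : IsCompact K)
    (hint : (interior K).Nonempty) : ∃ v₀ ∈ K, ∃ v : Fin n → Fin n → ℝ, (∀ i, v i ∈ K) ∧
      (Matrix.of fun i => v i - v₀).det ≠ 0 ∧
      ∀ z ∈ K, ∃ t : Fin n → ℝ, z - v₀ = t ᵥ* (Matrix.of fun i => v i - v₀) ∧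
        (∀ i, t i ≤ 1) ∧ 0 ≤ ∑ i, t i := by
  let F : (Fin n → ℝ) × (Fin n → Fin n → ℝ) → ℝ := fun p =>
    |(Matrix.of fun i => p.2 i - p.1).det|
  have hF : Continuous F := by
    refine continuous_abs.comp (Continuous.matrix_det ?_)
    exact continuous_matrix fun i j => by simp only [Matrix.of_apply, Pi.sub_apply]; fun_prop
  obtain ⟨u₀, hu₀, u, hu, hdet⟩ := exists_det_ne_zero_of_interior_nonempty hint
  have hcomp : IsCompact (K ×ˢ (Set.univ.pi fun _ : Fin n => K)) :=
    hK.prod (isCompact_univ_pi fun _ => hK)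
  obtain ⟨⟨v₀, v⟩, ⟨hv₀, hv⟩, hmax⟩ := hcomp.exists_isMaxOn ⟨(u₀, u), hu₀, fun i _ => hu i⟩
    hF.continuousOn
  have hv' : ∀ i, v i ∈ K := fun i => hv i (mem_univ i)
  have hmax' : ∀ w₀ ∈ K, ∀ w : Fin n → Fin n → ℝ, (∀ i, w i ∈ K) →
      |(Matrix.of fun i => w i - w₀).det| ≤ |(Matrix.of fun i => v i - v₀).det| :=
    fun w₀ h₀ w hw => hmax (show (w₀, w) ∈ _ from ⟨h₀, fun i _ => hw i⟩)
  set a : Matrix (Fin n) (Fin n) ℝ := Matrix.of fun i => v i - v₀ with ha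
  have hD : 0 < |a.det| := (abs_pos.2 hdet).trans_le (hmax' u₀ hu₀ u hu)
  have hunit : IsUnit a.det := isUnit_iff_ne_zero.2 (abs_pos.1 hD)
  refine ⟨v₀, hv₀, v, hv', abs_pos.1 hD, fun z hz => ⟨(z - v₀) ᵥ* a⁻¹, ?_, ?_⟩⟩
  · rw [Matrix.vecMul_vecMul, Matrix.nonsing_inv_mul _ hunit, Matrix.vecMul_one]
  set t := (z - v₀) ᵥ* a⁻¹ with ht
  have hta : t ᵥ* a = z - v₀ := by
    rw [ht, Matrix.vecMul_vecMul, Matrix.nonsing_inv_mul _ hunit, Matrix.vecMul_one]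
  constructor
  · intro i
    -- Replacing the vertex `v i` by `z` multiplies the determinant by `t i`, so maximality forces
    -- `|t i| ≤ 1`.
    have h1 := hmax' v₀ hv₀ (Function.update v i z) fun j => by
      rcases eq_or_ne j i with rfl | hj
      · simpa using hz
      · simpa [hj] using hv' j
    have h2 : (Matrix.of fun j => Function.update v i z j - v₀) =
        a.updateRow i (∑ k, t k • a k) := by
      ext j l
      have h3 : (∑ k, t k • a k) l = (z - v₀) l := by
        rw [← hta]; simp [Matrix.vecMul, dotProduct]
      rcases eq_or_ne j i with rfl | hj
      · rw [Matrix.updateRow_self, h3]; simp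
      · rw [Matrix.updateRow_ne hj]; simp [hj, ha]
    rw [h2, Matrix.det_updateRow_sum, smul_eq_mul, abs_mul] at h1
    exact (le_abs_self _).trans (le_of_mul_le_mul_right (by linarith) hD)
  -- Replacing `v₀` by `z` is a rank-one perturbation that multiplies the determinant by `1 - ∑ i, t
  -- i`, the barycentric coordinate at `v₀`.
  · have h1 := hmax' z hz v hv'
    have h2 : (Matrix.of fun j => v j - z) =
        (1 - Matrix.replicateCol Unit (fun _ : Fin n => (1 : ℝ)) * Matrix.replicateRow Unit t) * a := by
      rw [Matrix.sub_mul, Matrix.one_mul, Matrix.mul_assoc, ← Matrix.replicateRow_vecMul, hta]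
      ext i j
      simp [ha, Matrix.mul_apply]
    rw [h2, Matrix.det_mul, Matrix.det_one_sub_mul_comm, Matrix.det_unique, abs_mul] at h1
    have h3 := le_of_mul_le_mul_right (h1.trans_eq (one_mul _).symm) hD
    have h4 := (abs_le.1 h3).2
    simp [Matrix.mul_apply] at h4
    linarith [(abs_le.1 h3).1]

theorem volume_le_of_subset_affine_image {n : ℕ} {K S : Set (Fin n → ℝ)}
    (A : Matrix (Fin n) (Fin n) ℝ) (b : Fin n → ℝ) (h : ∀ z ∈ K, ∃ s ∈ S, z = b + A *ᵥ s) :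
    volume K ≤ ENNReal.ofReal |A.det| * volume S := by
  have hsub : K ⊆ (fun z => z + -b) ⁻¹' (Matrix.toLin' A '' S) := by
    intro z hz
    obtain ⟨s, hs, rfl⟩ := h z hz
    exact ⟨s, hs, by simp⟩
  refine (measure_mono hsub).trans ?_
  rw [measure_preimage_add_right, Measure.addHaar_image_linearMap, LinearMap.det_toLin']

theorem one_add_ones_det (n : ℕ) :
    (1 + Matrix.of fun _ _ : Fin n => (1 : ℝ)).det = n + 1 := by
  have : (Matrix.of fun _ _ : Fin n => (1 : ℝ)) =
      Matrix.replicateCol Unit (fun _ => (1 : ℝ)) * Matrix.replicateRow Unit fun _ => (1 : ℝ) := by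
    ext i j; simp [Matrix.mul_apply]
  rw [this, Matrix.det_one_add_replicateCol_mul_replicateRow]
  simp [dotProduct, add_comm]

theorem volume_unitBall (n : ℕ) : volume (Metric.ball (0 : EuclideanSpace ℝ (Fin n)) 1) =
    ENNReal.ofReal (√π ^ n / Gamma (n / 2 + 1)) := by
  rcases Nat.eq_zero_or_pos n with rfl | hn
  · rw [volume_euclideanSpace_eq_dirac]
    simp
  · have : Nonempty (Fin n) := ⟨⟨0, hn⟩⟩
    simp [EuclideanSpace.volume_ball]

/-- A weak form of the Blaschke-Santaló inequality: some point of a convex body has a polar body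
whose volume is at most `n ^ n` times the optimal bound. -/
theorem exists_volume_mul_volume_polar_le {n : ℕ} {K : Set (Fin n → ℝ)} (hK : IsCompact K)
    (hc : Convex ℝ K) (hne : K.Nonempty) :
    ∃ z ∈ K, volume K * volume {y : Fin n → ℝ | ∀ w ∈ K, y ⬝ᵥ (w - z) ≤ 1} ≤
      (n : ℝ≥0∞) ^ n * volume (Metric.ball (0 : EuclideanSpace ℝ (Fin n)) 1) ^ 2 := by
  by_cases hint : (interior K).Nonempty
  swap
  · obtain ⟨z, hz⟩ := hne
    refine ⟨z, hz, ?_⟩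
    have h0 : volume K = 0 := by
      have hf := hc.addHaar_frontier volume
      rwa [hK.isClosed.frontier_eq, not_nonempty_iff_eq_empty.1 hint, sdiff_empty] at hf
    simp [h0]
  obtain ⟨v₀, hv₀, v, hv, hdet, hmax⟩ := exists_maximal_simplex hK hint
  set a : Matrix (Fin n) (Fin n) ℝ := Matrix.of fun i => v i - v₀ with ha
  -- The centroid of the simplex: the vectors from it to the vertices sum to zero, which bounds the
  -- polar body.
  set z : Fin n → ℝ := ((n : ℝ) + 1)⁻¹ • (v₀ + ∑ i, v i) with hzdef
  have hn1 : (0 : ℝ) < (n : ℝ) + 1 := by positivity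
  have hz : z ∈ K := by
    have := hc.sum_mem (t := Finset.univ) (w := fun _ : Fin (n + 1) => ((n : ℝ) + 1)⁻¹)
      (z := Fin.cons v₀ v) (fun _ _ => by positivity) (by simp; field_simp)
      (fun i _ => by refine Fin.cases ?_ (fun j => ?_) i <;> simp [hv₀, hv])
    rw [Fin.sum_univ_succ] at this
    simpa [hzdef, smul_add, Finset.smul_sum] using this
  refine ⟨z, hz, ?_⟩
  have hvolK : volume K ≤ ENNReal.ofReal |a.det| * ENNReal.ofReal ((n : ℝ) ^ n / n.factorial) := by
    have h1 : volume K ≤ ENNReal.ofReal |(-aᵀ).det| * volume (cornerSimplex n n) := by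
      refine volume_le_of_subset_affine_image (-aᵀ) (v₀ + (fun _ => 1) ᵥ* a) fun w hw => ?_
      obtain ⟨t, ht, ht1, ht0⟩ := hmax w hw
      -- The slacks `1 - t i` are nonnegative with sum at most `n`. This puts `K` into a simplex `n`
      -- times as large as the inscribed one, the source of the factor `n ^ n`.
      refine ⟨fun i => 1 - t i, ⟨fun i => sub_nonneg.2 (ht1 i), ?_⟩, ?_⟩
      · simp [Finset.sum_sub_distrib, ht0]
      · have : (fun i => 1 - t i) = (fun _ => (1 : ℝ)) - t := rfl
        rw [Matrix.neg_mulVec, Matrix.mulVec_transpose, this, Matrix.sub_vecMul, ← ht]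
        abel
    refine h1.trans ?_
    rw [Matrix.det_neg, Matrix.det_transpose, abs_mul, abs_pow, abs_neg, abs_one, one_pow, one_mul]
    gcongr
    exact volume_cornerSimplex_le n (by positivity)
  have hvolP : volume {y : Fin n → ℝ | ∀ w ∈ K, y ⬝ᵥ (w - z) ≤ 1} ≤ ENNReal.ofReal |a.det|⁻¹ *
      (ENNReal.ofReal (n + 1) * ENNReal.ofReal (((n : ℝ) + 1) ^ n / n.factorial)) := by
    set J : Matrix (Fin n) (Fin n) ℝ := 1 + Matrix.of fun _ _ => (1 : ℝ) with hJ
    set Q : Set (Fin n → ℝ) := Matrix.toLin' a '' {y | ∀ w ∈ K, y ⬝ᵥ (w - z) ≤ 1} with hQ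
    have hdet' : LinearMap.det (Matrix.toLin' a) ≠ 0 := by rwa [LinearMap.det_toLin']
    have h1 : volume Q ≤ ENNReal.ofReal |(-J).det| * volume (cornerSimplex n ((n : ℝ) + 1)) := by
      refine volume_le_of_subset_affine_image (-J) (fun _ => (n : ℝ) + 1) ?_
      rintro _ ⟨y, hy, rfl⟩
      have hsum : (v₀ - z) + ∑ i, (v i - z) = 0 := by
        rw [Finset.sum_sub_distrib, Finset.sum_const, Finset.card_univ, Fintype.card_fin,
          ← Nat.cast_smul_eq_nsmul ℝ]
        have : ((n : ℝ) + 1) • z = v₀ + ∑ i, v i := by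
          rw [hzdef, smul_smul, mul_inv_cancel₀ hn1.ne', one_smul]
        rw [add_smul, one_smul] at this
        have h3 : v₀ - z + (∑ i, v i - (n : ℝ) • z) = (v₀ + ∑ i, v i) - ((n : ℝ) • z + z) := by abel
        rw [h3, this, sub_self]
      have hsum' : y ⬝ᵥ (v₀ - z) + ∑ i, y ⬝ᵥ (v i - z) = 0 := by
        have := congrArg (fun x => y ⬝ᵥ x) hsum
        simpa only [dotProduct_add, dotProduct_sum, dotProduct_zero] using this
      -- Only the constraints at the vertices are used. All `n + 1` slacks, the one at `v₀`
      -- included, sum to `n + 1`; eliminating the slack at `v₀` produces the matrix `J` of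
      -- determinant `n + 1`.
      refine ⟨fun i => 1 - y ⬝ᵥ (v i - z), ⟨fun i => sub_nonneg.2 (hy _ (hv i)), ?_⟩, ?_⟩
      · have := hy v₀ hv₀
        rw [Finset.sum_sub_distrib]
        simp only [Finset.sum_const, Finset.card_univ, Fintype.card_fin, nsmul_eq_mul, mul_one]
        linarith
      · ext i
        have e1 : (Matrix.toLin' a y) i = y ⬝ᵥ (v i - z) - y ⬝ᵥ (v₀ - z) := by
          rw [Matrix.toLin'_apply, Matrix.mulVec, dotProduct_comm, ← dotProduct_sub]
          congr 1
          simp [ha]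
          rfl
        have e2 : ((-J) *ᵥ fun i => 1 - y ⬝ᵥ (v i - z)) i =
            -((1 - y ⬝ᵥ (v i - z)) + ∑ j, (1 - y ⬝ᵥ (v j - z))) := by
          rw [Matrix.neg_mulVec, hJ, Matrix.add_mulVec, Matrix.one_mulVec]
          simp [Matrix.mulVec, dotProduct]
        rw [e1, Pi.add_apply, e2, Finset.sum_sub_distrib]
        simp only [Finset.sum_const, Finset.card_univ, Fintype.card_fin, nsmul_eq_mul, mul_one]
        linarith
    have h2 : {y : Fin n → ℝ | ∀ w ∈ K, y ⬝ᵥ (w - z) ≤ 1} ⊆ Matrix.toLin' a ⁻¹' Q :=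
      subset_preimage_image _ _
    refine (measure_mono h2).trans ?_
    rw [Measure.addHaar_preimage_linearMap _ hdet', LinearMap.det_toLin', abs_inv]
    rw [Matrix.det_neg, abs_mul, abs_pow, abs_neg, abs_one, one_pow, one_mul, one_add_ones_det,
      abs_of_pos hn1] at h1
    gcongr
    refine h1.trans ?_
    gcongr
    exact volume_cornerSimplex_le n hn1.le
  refine (mul_le_mul' hvolK hvolP).trans ?_
  have hD : 0 < |a.det| := abs_pos.2 hdet
  rw [volume_unitBall,
    ← ENNReal.ofReal_mul (by positivity), ← ENNReal.ofReal_mul (by positivity),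
    ← ENNReal.ofReal_mul (by positivity), ← ENNReal.ofReal_mul (by positivity),
    ← ENNReal.ofReal_natCast, ← ENNReal.ofReal_pow (by positivity),
    ← ENNReal.ofReal_pow (by positivity), ← ENNReal.ofReal_mul (by positivity)]
  refine ENNReal.ofReal_le_ofReal ?_
  have hG : 0 < Gamma ((n : ℝ) / 2 + 1) := Real.Gamma_pos_of_pos (by positivity)
  have hf : (0 : ℝ) < n.factorial := by exact_mod_cast n.factorial_pos
  have hs := simplex_santalo n
  have e1 : (√π ^ n / Gamma ((n : ℝ) / 2 + 1)) ^ 2 = π ^ n / Gamma ((n : ℝ) / 2 + 1) ^ 2 := by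
    rw [div_pow, ← pow_mul, mul_comm n 2, pow_mul, Real.sq_sqrt Real.pi_pos.le]
  have e2 : |a.det| * ((n : ℝ) ^ n / n.factorial) *
      (|a.det|⁻¹ * ((n + 1) * (((n : ℝ) + 1) ^ n / n.factorial))) =
      (n : ℝ) ^ n * (((n : ℝ) + 1) ^ (n + 1) / (n.factorial : ℝ) ^ 2) := by
    field_simp
    ring
  rw [e1, e2]
  refine mul_le_mul_of_nonneg_left ?_ (by positivity)
  rw [div_le_div_iff₀ (by positivity) (by positivity)]
  exact hs

/-- The version of `exists_volume_mul_volume_polar_le` in Euclidean space. -/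
theorem exists_volume_mul_volume_polar_le_euclidean {n : ℕ} {K : Set (EuclideanSpace ℝ (Fin n))}
    (hK : IsCompact K) (hc : Convex ℝ K) (hne : K.Nonempty) :
    ∃ z ∈ K, volume K * volume {y : EuclideanSpace ℝ (Fin n) | ∀ w ∈ K, inner ℝ y (w - z) ≤ 1} ≤
      (n : ℝ≥0∞) ^ n * volume (Metric.ball (0 : EuclideanSpace ℝ (Fin n)) 1) ^ 2 := by
  let e : EuclideanSpace ℝ (Fin n) ≃L[ℝ] (Fin n → ℝ) := EuclideanSpace.equiv (Fin n) ℝ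
  have hpre : ∀ S : Set (EuclideanSpace ℝ (Fin n)), volume (e '' S) = volume S := by
    intro S
    have h1 : e '' S = (WithLp.toLp 2 : (Fin n → ℝ) → EuclideanSpace ℝ (Fin n)) ⁻¹' S := by
      ext x
      constructor
      · rintro ⟨y, hy, rfl⟩
        exact hy
      · intro hx
        exact ⟨_, hx, rfl⟩
    rw [h1]
    exact (PiLp.volume_preserving_toLp (Fin n)).measure_preimage_emb
      (MeasurableEquiv.toLp 2 (Fin n → ℝ)).measurableEmbedding S
  obtain ⟨_, ⟨z, hz, rfl⟩, h⟩ := exists_volume_mul_volume_polar_le (hK.image e.continuous)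
    (hc.linear_image e.toLinearEquiv.toLinearMap) (hne.image e)
  refine ⟨z, hz, le_trans (le_of_eq ?_) h⟩
  rw [hpre, ← hpre {y | _}]
  congr 2
  ext y
  constructor
  · rintro ⟨y, hy, rfl⟩ _ ⟨w, hw, rfl⟩
    refine le_trans (le_of_eq ?_) (hy w hw)
    rw [EuclideanSpace.inner_eq_star_dotProduct, dotProduct_comm]
    simp [e]
    rfl
  · intro hy
    refine ⟨e.symm y, fun w hw => le_trans (le_of_eq ?_) (hy (e w) ⟨w, hw, rfl⟩), by simp⟩
    rw [EuclideanSpace.inner_eq_star_dotProduct, dotProduct_comm]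
    simp [e]
    rfl

end ConvexGeometry

/-! ### The Riemannian volume: independence of charts and change of variables. -/

section Volume

variable (n : ℕ) {M : Type*} [TopologicalSpace M] [ChartedSpace (EuclideanSpace ℝ (Fin n)) M]
  [RiemannianBundle (fun x : M => TangentSpace (𝓡 n) x)]

/-- The absolute determinant of a linear map into `T_x M`, in orthonormal bases. -/
def absDetAt (x : M) (A : EuclideanSpace ℝ (Fin n) →L[ℝ] TangentSpace (𝓡 n) x) : ℝ :=
  |(Matrix.of fun i j : Fin n =>
    inner ℝ (orthoFrame n x i) (A (EuclideanSpace.single j (1 : ℝ)))).det|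

theorem absDetAt_congr {x y : M} (h : x = y)
    (A B : EuclideanSpace ℝ (Fin n) →L[ℝ] EuclideanSpace ℝ (Fin n)) (hAB : A = B) :
    absDetAt n x A = absDetAt n y B := by
  subst h hAB; rfl

theorem absDetAt_comp (x : M) (A : EuclideanSpace ℝ (Fin n) →L[ℝ] TangentSpace (𝓡 n) x)
    (B : EuclideanSpace ℝ (Fin n) →L[ℝ] EuclideanSpace ℝ (Fin n)) :
    absDetAt n x (A ∘L B) = absDetAt n x A * |B.det| := by
  have hB : B.det = (LinearMap.toMatrix (EuclideanSpace.basisFun (Fin n) ℝ).toBasis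
      (EuclideanSpace.basisFun (Fin n) ℝ).toBasis B.toLinearMap).det := by
    rw [LinearMap.det_toMatrix]
  rw [absDetAt, absDetAt, hB, ← abs_mul, ← Matrix.det_mul]
  congr 2
  ext i j
  have h1 : B (EuclideanSpace.single j (1 : ℝ)) =
      ∑ k, (B (EuclideanSpace.single j (1 : ℝ))) k • EuclideanSpace.single k (1 : ℝ) := by
    conv_lhs => rw [← (EuclideanSpace.basisFun (Fin n) ℝ).sum_repr
      (B (EuclideanSpace.single j (1 : ℝ)))]
    simp
  rw [Matrix.mul_apply, Matrix.of_apply, ContinuousLinearMap.comp_apply, h1, map_sum, inner_sum]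
  refine Finset.sum_congr rfl fun k _ => ?_
  rw [map_smul, inner_smul_right, mul_comm, Matrix.of_apply, LinearMap.toMatrix_apply]
  simp

/-- The Jacobian of a map from Euclidean space to a Riemannian manifold. -/
def jac (f : EuclideanSpace ℝ (Fin n) → M) (u : EuclideanSpace ℝ (Fin n)) : ℝ :=
  absDetAt n (f u) (mfderiv 𝓘(ℝ, EuclideanSpace ℝ (Fin n)) (𝓡 n) f u)

theorem jac_congr {f g : EuclideanSpace ℝ (Fin n) → M} {u : EuclideanSpace ℝ (Fin n)}
    (h : f =ᶠ[𝓝 u] g) : jac n f u = jac n g u :=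
  absDetAt_congr n h.eq_of_nhds _ _ h.mfderiv_eq

/-- The Gram matrix of the coordinate fields is `Cᵀ C`, with `C` their coefficients in an
orthonormal frame. -/
theorem volDensity_eq_jac (z : M) (u : EuclideanSpace ℝ (Fin n)) :
    volDensity n z u = jac n (extChartAt (𝓡 n) z).symm u := by
  have : (Matrix.of fun i j : Fin n => inner ℝ (coordVec n z u i) (coordVec n z u j)) =
      (Matrix.of fun i j : Fin n => inner ℝ (orthoFrame n ((extChartAt (𝓡 n) z).symm u) i)
        (coordVec n z u j)).transpose * (Matrix.of fun i j : Fin n =>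
          inner ℝ (orthoFrame n ((extChartAt (𝓡 n) z).symm u) i) (coordVec n z u j)) := by
    ext i j
    rw [Matrix.mul_apply, Matrix.of_apply, ← (orthoFrame n _).sum_inner_mul_inner]
    refine Finset.sum_congr rfl fun k _ => ?_
    rw [Matrix.transpose_apply, Matrix.of_apply, Matrix.of_apply, real_inner_comm]
  rw [volDensity, this, Matrix.det_mul, Matrix.det_transpose, Real.sqrt_mul_self_eq_abs]
  rfl

variable [IsManifold (𝓡 n) ∞ M]

theorem jac_eq_volDensity_mul {f : EuclideanSpace ℝ (Fin n) → M} {u : EuclideanSpace ℝ (Fin n)}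
    (hf : MDifferentiableAt 𝓘(ℝ, EuclideanSpace ℝ (Fin n)) (𝓡 n) f u) (z : M)
    (hz : f u ∈ (extChartAt (𝓡 n) z).source) :
    jac n f u = volDensity n z (extChartAt (𝓡 n) z (f u)) *
      |(fderiv ℝ (extChartAt (𝓡 n) z ∘ f) u).det| := by
  have hz' : f u ∈ (chartAt (EuclideanSpace ℝ (Fin n)) z).source := by
    rwa [extChartAt_source] at hz
  have hsrc : ∀ᶠ v in 𝓝 u, f v ∈ (extChartAt (𝓡 n) z).source :=
    hf.continuousAt.eventually_mem ((isOpen_extChartAt_source z).mem_nhds hz)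
  have heq : f =ᶠ[𝓝 u] (extChartAt (𝓡 n) z).symm ∘ (extChartAt (𝓡 n) z ∘ f) := by
    filter_upwards [hsrc] with v hv
    exact ((extChartAt (𝓡 n) z).left_inv hv).symm
  have hg : MDifferentiableAt 𝓘(ℝ, EuclideanSpace ℝ (Fin n)) 𝓘(ℝ, EuclideanSpace ℝ (Fin n))
      (extChartAt (𝓡 n) z ∘ f) u := (mdifferentiableAt_extChartAt hz').comp u hf
  have hs : MDifferentiableAt 𝓘(ℝ, EuclideanSpace ℝ (Fin n)) (𝓡 n) (extChartAt (𝓡 n) z).symm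
      ((extChartAt (𝓡 n) z ∘ f) u) :=
    (mdifferentiableOn_extChartAt_symm.mdifferentiableAt
      ((isOpen_extChartAt_target z).mem_nhds ((extChartAt (𝓡 n) z).map_source hz)))
  rw [jac_congr n heq, jac, mfderiv_comp u hs hg, volDensity_eq_jac, jac]
  rw [← mfderiv_eq_fderiv]
  exact absDetAt_comp n _ _ _

variable [MeasurableSpace M] [BorelSpace M]

theorem chartVol_apply (z : M) {A : Set M} (hA : MeasurableSet A) :
    chartVol n z A = ∫⁻ u in (extChartAt (𝓡 n) z).target ∩ (extChartAt (𝓡 n) z).symm ⁻¹' A,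
      ENNReal.ofReal (volDensity n z u) := by
  have hT : MeasurableSet (extChartAt (𝓡 n) z).target := (isOpen_extChartAt_target z).measurableSet
  have hm : AEMeasurable (extChartAt (𝓡 n) z).symm
      (((volume : Measure (EuclideanSpace ℝ (Fin n))).restrict
        (extChartAt (𝓡 n) z).target).withDensity
          fun u => ENNReal.ofReal (volDensity n z u)) :=
    ((continuousOn_extChartAt_symm z).aemeasurable hT).mono_ac (withDensity_absolutelyContinuous _ _)
  rw [chartVol, Measure.map_apply_of_aemeasurable hm hA, withDensity_apply',
    Measure.restrict_restrict' hT, inter_comm]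

theorem chartVol_inter_source (z : M) {A : Set M} (hA : MeasurableSet A) :
    chartVol n z (A ∩ (extChartAt (𝓡 n) z).source) = chartVol n z A := by
  rw [chartVol_apply n z hA,
    chartVol_apply n z (hA.inter (isOpen_extChartAt_source z).measurableSet)]
  congr 2
  ext u
  constructor
  · rintro ⟨h1, h2, _⟩
    exact ⟨h1, h2⟩
  · rintro ⟨h1, h2⟩
    exact ⟨h1, h2, (extChartAt (𝓡 n) z).map_target h1⟩

variable [T2Space M]

theorem measurableSet_image {s : Set (EuclideanSpace ℝ (Fin n))} (hs : MeasurableSet s)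
    {f : EuclideanSpace ℝ (Fin n) → M}
    (hf : ∀ u ∈ s, MDifferentiableAt 𝓘(ℝ, EuclideanSpace ℝ (Fin n)) (𝓡 n) f u) (hinj : InjOn f s) :
    MeasurableSet (f '' s) :=
  hs.image_of_continuousOn_injOn (fun u hu => (hf u hu).continuousAt.continuousWithinAt) hinj

/-- Euclidean change of variables for `f` read in the chart; the chain rule absorbs the chart
density into `jac n f`. The right side no longer mentions the chart, whence the agreement of two
charts on overlaps. -/
theorem chartVol_image {s : Set (EuclideanSpace ℝ (Fin n))} (hs : MeasurableSet s)
    {f : EuclideanSpace ℝ (Fin n) → M}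
    (hf : ∀ u ∈ s, MDifferentiableAt 𝓘(ℝ, EuclideanSpace ℝ (Fin n)) (𝓡 n) f u) (hinj : InjOn f s)
    (z : M) (hz : MapsTo f s (extChartAt (𝓡 n) z).source) :
    chartVol n z (f '' s) = ∫⁻ u in s, ENNReal.ofReal (jac n f u) := by
  rw [chartVol_apply n z (measurableSet_image n hs hf hinj),
    ← (extChartAt (𝓡 n) z).image_eq_target_inter_inv_preimage hz.image_subset, ← image_comp,
    lintegral_image_eq_lintegral_abs_det_fderiv_mul volume hs
      (f' := fun u => fderiv ℝ (extChartAt (𝓡 n) z ∘ f) u)]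
  · refine setLIntegral_congr_fun hs fun u hu => ?_
    simp only [jac_eq_volDensity_mul n (hf u hu) z (hz hu), Function.comp_apply]
    rw [mul_comm, ENNReal.ofReal_mul (show 0 ≤ volDensity n z _ from Real.sqrt_nonneg _)]
  · intro u hu
    have hz' : f u ∈ (chartAt (EuclideanSpace ℝ (Fin n)) z).source := by
      have := hz hu
      rwa [extChartAt_source] at this
    have hg : MDifferentiableAt 𝓘(ℝ, EuclideanSpace ℝ (Fin n)) 𝓘(ℝ, EuclideanSpace ℝ (Fin n))
      (extChartAt (𝓡 n) z ∘ f) u := (mdifferentiableAt_extChartAt hz').comp u (hf u hu)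
    exact hg.differentiableAt.hasFDerivAt.hasFDerivWithinAt
  · exact (extChartAt (𝓡 n) z).injOn.comp hinj hz

theorem measurableSet_inter_preimage_of_continuousOn {X Y : Type*} [TopologicalSpace X]
    [MeasurableSpace X] [BorelSpace X] [TopologicalSpace Y] [MeasurableSpace Y] [BorelSpace Y]
    {s : Set X} (hs : MeasurableSet s) {f : X → Y} (hf : ContinuousOn f s) {D : Set Y}
    (hD : MeasurableSet D) : MeasurableSet (s ∩ f ⁻¹' D) := by
  have := hs.subtype_image ((continuousOn_iff_continuous_domRestrict.1 hf).measurable hD)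
  convert! this using 1
  ext u
  constructor
  · rintro ⟨h1, h2⟩
    exact ⟨⟨u, h1⟩, h2, rfl⟩
  · rintro ⟨v, hv, rfl⟩
    exact ⟨v.2, hv⟩

theorem chartVol_eq_chartVol (z z' : M) {A : Set M} (hA : MeasurableSet A)
    (h : A ⊆ (extChartAt (𝓡 n) z).source) (h' : A ⊆ (extChartAt (𝓡 n) z').source) :
    chartVol n z A = chartVol n z' A := by
  set e := extChartAt (𝓡 n) z with he
  set s := e '' A with hsdef
  have hst : s ⊆ e.target := fun u hu => by
    obtain ⟨x, hx, rfl⟩ := hu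
    exact e.map_source (h hx)
  have hs : MeasurableSet s := by
    rw [hsdef, e.image_eq_target_inter_inv_preimage h]
    exact measurableSet_inter_preimage_of_continuousOn
      (isOpen_extChartAt_target (I := 𝓡 n) z).measurableSet (continuousOn_extChartAt_symm z) hA
  have himg : e.symm '' s = A := e.symm_image_image_of_subset_source h
  have hd : ∀ u ∈ s, MDifferentiableAt 𝓘(ℝ, EuclideanSpace ℝ (Fin n)) (𝓡 n) e.symm u :=
    fun u hu => mdifferentiableOn_extChartAt_symm.mdifferentiableAt
      ((isOpen_extChartAt_target z).mem_nhds (hst hu))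
  have hinj : InjOn e.symm s := e.symm.injOn.mono hst
  have hmaps : MapsTo e.symm s A := mapsTo_iff_image_subset.2 himg.subset
  rw [← himg, chartVol_image n hs hd hinj z (hmaps.mono_right h),
    chartVol_image n hs hd hinj z' (hmaps.mono_right h')]

variable [SecondCountableTopology M]

variable (M) in
/-- A countable Borel partition of `M` into pieces that lie in chart domains. -/
theorem exists_chart_partition [Nonempty M] : ∃ (z : ℕ → M) (D : ℕ → Set M),
    (∀ i, MeasurableSet (D i)) ∧ (∀ i, D i ⊆ (extChartAt (𝓡 n) (z i)).source) ∧
    Pairwise (Function.onFun Disjoint D) ∧ ⋃ i, D i = univ := by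
  obtain ⟨t, ht, hcov⟩ := countable_cover_nhds
    fun x : M => extChartAt_source_mem_nhds (I := 𝓡 n) x
  have hne : t.Nonempty := by
    by_contra h
    rw [not_nonempty_iff_eq_empty.1 h] at hcov
    simp at hcov
    exact not_isEmpty_of_nonempty M (Set.univ_eq_empty_iff.1 hcov.symm)
  obtain ⟨z, rfl⟩ := ht.exists_eq_range hne
  refine ⟨z, disjointed fun i => (extChartAt (𝓡 n) (z i)).source,
    fun i => MeasurableSet.disjointed (fun i => (isOpen_extChartAt_source _).measurableSet) i,
    fun i => disjointed_subset _ i, disjoint_disjointed _, ?_⟩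
  rw [iUnion_disjointed]
  rwa [biUnion_range] at hcov

theorem measure_eq_tsum_inter {X : Type*} [MeasurableSpace X] (μ : Measure X) {D : ℕ → Set X}
    (hD : ∀ i, MeasurableSet (D i)) (hdisj : Pairwise (Function.onFun Disjoint D))
    (hcov : ⋃ i, D i = univ) {A : Set X} (hA : MeasurableSet A) :
    μ A = ∑' i, μ (A ∩ D i) := by
  rw [← measure_iUnion (fun i j hij => (hdisj hij).mono inter_subset_right inter_subset_right)
    fun i => hA.inter (hD i), ← inter_iUnion, hcov, inter_univ]

/-- On a chart domain the Riemannian volume is the volume of the chart. -/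
theorem riemVol_eq_chartVol (z : M) {A : Set M} (hA : MeasurableSet A)
    (h : A ⊆ (extChartAt (𝓡 n) z).source) : riemVol n A = chartVol n z A := by
  refine le_antisymm ?_ (Measure.le_iff'.1 (le_iSup (chartVol (M := M) n) z) A)
  have : Nonempty M := ⟨z⟩
  obtain ⟨zs, D, hD, hDs, hdisj, hcov⟩ := exists_chart_partition n M
  -- The measure glued along the partition dominates every chart measure, hence also their supremum.
  have hle : riemVol (M := M) n ≤ Measure.sum fun i => (chartVol n (zs i)).restrict (D i) := by
    refine iSup_le fun w => Measure.le_iff.2 fun B hB => ?_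
    have hw := (isOpen_extChartAt_source (I := 𝓡 n) w).measurableSet
    rw [← chartVol_inter_source n w hB, measure_eq_tsum_inter _ hD hdisj hcov (hB.inter hw),
      Measure.sum_apply _ hB]
    refine ENNReal.tsum_le_tsum fun i => ?_
    rw [Measure.restrict_apply hB, chartVol_eq_chartVol n w (zs i) ((hB.inter hw).inter (hD i))
      (inter_subset_left.trans inter_subset_right) (inter_subset_right.trans (hDs i))]
    exact measure_mono (inter_subset_inter_left _ inter_subset_left)
  refine (hle A).trans ?_
  rw [Measure.sum_apply _ hA, measure_eq_tsum_inter (chartVol n z) hD hdisj hcov hA]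
  refine ENNReal.tsum_le_tsum fun i => ?_
  rw [Measure.restrict_apply hA, chartVol_eq_chartVol n z (zs i) (hA.inter (hD i))
    (inter_subset_left.trans h) (inter_subset_right.trans (hDs i))]

/-- The change of variables formula for the Riemannian volume. -/
theorem riemVol_image {s : Set (EuclideanSpace ℝ (Fin n))} (hs : MeasurableSet s)
    {f : EuclideanSpace ℝ (Fin n) → M}
    (hf : ∀ u ∈ s, MDifferentiableAt 𝓘(ℝ, EuclideanSpace ℝ (Fin n)) (𝓡 n) f u) (hinj : InjOn f s) :
    riemVol n (f '' s) = ∫⁻ u in s, ENNReal.ofReal (jac n f u) := by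
  have : Nonempty M := ⟨f 0⟩
  obtain ⟨zs, D, hD, hDs, hdisj, hcov⟩ := exists_chart_partition n M
  have hcont : ContinuousOn f s := fun u hu => (hf u hu).continuousAt.continuousWithinAt
  have hm : ∀ i, MeasurableSet (s ∩ f ⁻¹' D i) := fun i =>
    measurableSet_inter_preimage_of_continuousOn hs hcont (hD i)
  rw [measure_eq_tsum_inter _ hD hdisj hcov (measurableSet_image n hs hf hinj)]
  have hU : s = ⋃ i, s ∩ f ⁻¹' D i := by
    rw [← inter_iUnion, ← preimage_iUnion, hcov, preimage_univ, inter_univ]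
  conv_rhs => rw [hU, lintegral_iUnion hm fun i j hij =>
    ((hdisj hij).preimage f).mono inter_subset_right inter_subset_right]
  refine tsum_congr fun i => ?_
  have hf' : ∀ u ∈ s ∩ f ⁻¹' D i,
      MDifferentiableAt 𝓘(ℝ, EuclideanSpace ℝ (Fin n)) (𝓡 n) f u := fun u hu => hf u hu.1
  have hinj' := hinj.mono (inter_subset_left (s := s) (t := f ⁻¹' D i))
  have hmaps : MapsTo f (s ∩ f ⁻¹' D i) (extChartAt (𝓡 n) (zs i)).source := fun u hu => hDs i hu.2
  rw [← image_inter_preimage, riemVol_eq_chartVol n (zs i) (measurableSet_image n (hm i) hf' hinj')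
    hmaps.image_subset, chartVol_image n (hm i) hf' hinj' (zs i) hmaps]

/-- Differentiable maps send null sets to null sets. -/
theorem riemVol_image_eq_zero {t : Set (EuclideanSpace ℝ (Fin n))} (ht : volume t = 0)
    {f : EuclideanSpace ℝ (Fin n) → M}
    (hf : MDifferentiableOn 𝓘(ℝ, EuclideanSpace ℝ (Fin n)) (𝓡 n) f t) :
    riemVol n (f '' t) = 0 := by
  have : Nonempty M := ⟨f 0⟩
  obtain ⟨zs, D, -, hDs, -, hcov⟩ := exists_chart_partition n M
  have hsub : f '' t ⊆ ⋃ i, f '' (t ∩ f ⁻¹' D i) := by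
    rw [← image_iUnion, ← inter_iUnion, ← preimage_iUnion, hcov, preimage_univ, inter_univ]
  refine measure_mono_null hsub (measure_iUnion_null fun i => ?_)
  set e := extChartAt (𝓡 n) (zs i) with he
  have hnull : volume ((e ∘ f) '' (t ∩ f ⁻¹' D i)) = 0 := by
    refine addHaar_image_eq_zero_of_differentiableOn_of_addHaar_eq_zero volume ?_
      (measure_mono_null inter_subset_left ht)
    intro u hu
    have hz' : f u ∈ (chartAt (EuclideanSpace ℝ (Fin n)) (zs i)).source := by
      have := hDs i hu.2
      rwa [extChartAt_source] at this
    have hg : MDifferentiableWithinAt 𝓘(ℝ, EuclideanSpace ℝ (Fin n))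
        𝓘(ℝ, EuclideanSpace ℝ (Fin n)) (e ∘ f) (t ∩ f ⁻¹' D i) u :=
      (mdifferentiableAt_extChartAt hz').comp_mdifferentiableWithinAt u
        ((hf u hu.1).mono inter_subset_left)
    exact hg.differentiableWithinAt
  -- The null set has to be enlarged to a Borel one before `riemVol_image` applies to the inverse
  -- chart; `f` itself need not be injective.
  set T := e.target ∩ toMeasurable volume ((e ∘ f) '' (t ∩ f ⁻¹' D i)) with hT
  have hTm : MeasurableSet T :=
    (isOpen_extChartAt_target (I := 𝓡 n) (zs i)).measurableSet.inter (measurableSet_toMeasurable _ _)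
  have hT0 : volume T = 0 :=
    measure_mono_null inter_subset_right ((measure_toMeasurable _).trans hnull)
  have hd : ∀ u ∈ T, MDifferentiableAt 𝓘(ℝ, EuclideanSpace ℝ (Fin n)) (𝓡 n) e.symm u :=
    fun u hu => mdifferentiableOn_extChartAt_symm.mdifferentiableAt
      ((isOpen_extChartAt_target _).mem_nhds hu.1)
  have hinj : InjOn e.symm T := e.symm.injOn.mono inter_subset_left
  refine measure_mono_null (t := e.symm '' T) ?_ ?_
  · rintro _ ⟨u, hu, rfl⟩
    have hu' : f u ∈ e.source := hDs i hu.2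
    exact ⟨e (f u), ⟨e.map_source hu', subset_toMeasurable _ _ ⟨u, hu, rfl⟩⟩, e.left_inv hu'⟩
  · rw [riemVol_image n hTm hd hinj, Measure.restrict_eq_zero.2 hT0, lintegral_zero_measure]

end Volume

/-! ### Orthonormal linear coordinates on cotangent spaces. -/

section DualFrame

variable (n : ℕ) {M : Type*} [TopologicalSpace M] [ChartedSpace (EuclideanSpace ℝ (Fin n)) M]
  [RiemannianBundle (fun x : M => TangentSpace (𝓡 n) x)]

/-- The linear coordinates on `T*_x M` with respect to the basis dual to `orthoFrame n x`. -/
def dualFrame (x : M) : EuclideanSpace ℝ (Fin n) ≃L[ℝ] Cotangent n x :=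
  LinearEquiv.toContinuousLinearEquiv
    { toFun := fun ξ => ∑ j, ξ j • innerSL ℝ (orthoFrame n x j)
      map_add' := fun ξ η => by simp [add_smul, Finset.sum_add_distrib]
      map_smul' := fun r ξ => by simp [mul_smul, Finset.smul_sum]
      invFun := fun l => WithLp.toLp 2 fun j => l (orthoFrame n x j)
      left_inv := fun ξ => by
        ext j
        simp [orthonormal_iff_ite.1 (orthoFrame n x).orthonormal]
      right_inv := fun l => by
        refine ContinuousLinearMap.ext fun v => ?_
        conv_rhs => rw [← (orthoFrame n x).sum_repr v]
        simp [OrthonormalBasis.repr_apply_apply, mul_comm] }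

theorem dualFrame_apply (x : M) (ξ : EuclideanSpace ℝ (Fin n)) (v : TangentSpace (𝓡 n) x) :
    dualFrame n x ξ v = ∑ j, ξ j * inner ℝ (orthoFrame n x j) v := by
  simp [dualFrame]

theorem dualFrame_single (x : M) (j : Fin n) :
    dualFrame n x (EuclideanSpace.single j (1 : ℝ)) = innerSL ℝ (orthoFrame n x j) := by
  refine ContinuousLinearMap.ext fun v => ?_
  simp [dualFrame_apply]

theorem hasMFDerivAt_dualFrame (x : M) (ξ : EuclideanSpace ℝ (Fin n)) :
    HasMFDerivAt 𝓘(ℝ, EuclideanSpace ℝ (Fin n)) 𝓘(ℝ, Cotangent n x) (dualFrame n x) ξ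
      (dualFrame n x : EuclideanSpace ℝ (Fin n) →L[ℝ] Cotangent n x) :=
  (ContinuousLinearMap.hasFDerivAt (𝕜 := ℝ) (E := EuclideanSpace ℝ (Fin n)) (F := Cotangent n x)
    (dualFrame n x : EuclideanSpace ℝ (Fin n) →L[ℝ] Cotangent n x)).hasMFDerivAt

theorem mdifferentiableAt_dualFrame (x : M) (ξ : EuclideanSpace ℝ (Fin n)) :
    MDifferentiableAt 𝓘(ℝ, EuclideanSpace ℝ (Fin n)) 𝓘(ℝ, Cotangent n x) (dualFrame n x) ξ :=
  (hasMFDerivAt_dualFrame n x ξ).mdifferentiableAt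

end DualFrame

/-! ### The `c`-exponential as a diffeomorphism, and its Jacobian. -/

section Cost

variable (n : ℕ) {M N : Type*}
  [TopologicalSpace M] [ChartedSpace (EuclideanSpace ℝ (Fin n)) M]
  [TopologicalSpace N] [ChartedSpace (EuclideanSpace ℝ (Fin n)) N]

theorem isOpen_injLocus (c : M → N → ℝ) (x : M) : IsOpen (injLocus n c x) := by
  refine isOpen_iff_mem_nhds.2 fun y hy => ?_
  obtain ⟨U, hU, hc⟩ := hy
  have h : Tendsto (fun y' : N => (x, y')) (𝓝 y) (𝓝 (x, y)) :=
    (Continuous.prodMk_right x).continuousAt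
  filter_upwards [h.eventually (eventually_mem_nhds_iff.2 hU)] with y' hy'
  exact ⟨U, hy', hc⟩

variable [RiemannianBundle (fun x : M => TangentSpace (𝓡 n) x)]

theorem contMDiffAt_negD {c : M → N → ℝ} (ht : TwistFst n c) {x : M} {y : N}
    (hy : y ∈ injLocus n c x) : ContMDiffAt (𝓡 n) 𝓘(ℝ, Cotangent n x) ∞ (negD n c x) y :=
  (ht x).1.contMDiffAt ((isOpen_injLocus n c x).mem_nhds hy)

theorem mdifferentiableAt_negD {c : M → N → ℝ} (ht : TwistFst n c) {x : M} {y : N}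
    (hy : y ∈ injLocus n c x) : MDifferentiableAt (𝓡 n) 𝓘(ℝ, Cotangent n x) (negD n c x) y :=
  (contMDiffAt_negD n ht hy).mdifferentiableAt (by simp)

theorem injOn_negD {c : M → N → ℝ} (ht : TwistFst n c) (x : M) :
    InjOn (negD n c x) (injLocus n c x) :=
  injOn_iff_injective.2 (ht x).2.2.injective

/-- By twist `negD n c x` is an immersion between spaces of equal dimension, hence open by the
inverse function theorem. -/
theorem isOpen_expDomain [IsManifold (𝓡 n) ∞ N] {c : M → N → ℝ} (ht : TwistFst n c) (x : M) :
    IsOpen (expDomain n c x) := by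
  refine isOpen_iff_mem_nhds.2 ?_
  rintro _ ⟨y, hy, rfl⟩
  set e := extChartAt (𝓡 n) y with he
  set u := e y with hu
  have hys : e.symm u = y := extChartAt_to_inv y
  have hut : u ∈ e.target := mem_extChartAt_target y
  let g : EuclideanSpace ℝ (Fin n) → EuclideanSpace ℝ (Fin n) := fun v =>
    (dualFrame n x).symm (negD n c x (e.symm v))
  have hsymm : ContMDiffAt 𝓘(ℝ, EuclideanSpace ℝ (Fin n)) (𝓡 n) ∞ e.symm u :=
    (contMDiffOn_extChartAt_symm y).contMDiffAt ((isOpen_extChartAt_target y).mem_nhds hut)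
  have hneg : ContMDiffAt (𝓡 n) 𝓘(ℝ, Cotangent n x) ∞ (negD n c x) (e.symm u) := by
    rw [hys]; exact contMDiffAt_negD n ht hy
  have hcomp : ContMDiffAt 𝓘(ℝ, EuclideanSpace ℝ (Fin n)) 𝓘(ℝ, Cotangent n x) ∞
      (negD n c x ∘ e.symm) u := hneg.comp u hsymm
  have hcd : ContDiffAt ℝ ∞ (negD n c x ∘ e.symm) u := hcomp.contDiffAt
  have hinj : Function.Injective (fderiv ℝ (negD n c x ∘ e.symm) u) := by
    have hfd : mfderiv 𝓘(ℝ, EuclideanSpace ℝ (Fin n)) 𝓘(ℝ, Cotangent n x) (negD n c x ∘ e.symm) u =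
      fderiv ℝ (negD n c x ∘ e.symm) u := mfderiv_eq_fderiv
    rw [← hfd, mfderiv_comp u (hneg.mdifferentiableAt (by simp))
      (hsymm.mdifferentiableAt (by simp))]
    have h1 : Function.Injective (mfderiv (𝓡 n) 𝓘(ℝ, Cotangent n x) (negD n c x) (e.symm u)) := by
      rw [hys]; exact (ht x).2.1 y hy
    have h2 := isInvertible_mfderivWithin_extChartAt_symm (I := 𝓡 n) hut
    rw [ModelWithCorners.range_eq_univ, mfderivWithin_univ] at h2
    exact h1.comp h2.injective
  have hgs : HasStrictFDerivAt g
      (((dualFrame n x).symm : Cotangent n x →L[ℝ] EuclideanSpace ℝ (Fin n)) ∘L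
        fderiv ℝ (negD n c x ∘ e.symm) u) u :=
    ((dualFrame n x).symm : Cotangent n x →L[ℝ] EuclideanSpace ℝ (Fin n)).hasStrictFDerivAt.comp u
      (hcd.hasStrictFDerivAt (by simp))
  have hsurj := hgs.map_nhds_eq_of_surj (by
    rw [LinearMap.range_eq_top]
    refine LinearMap.injective_iff_surjective.1 ?_
    exact (dualFrame n x).symm.injective.comp hinj)
  have hpre : e.symm ⁻¹' injLocus n c x ∈ 𝓝 u := by
    refine hsymm.continuousAt.preimage_mem_nhds ?_
    rw [hys]; exact (isOpen_injLocus n c x).mem_nhds hy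
  have himg : g '' (e.symm ⁻¹' injLocus n c x) ∈ 𝓝 (g u) := by
    rw [← hsurj]; exact image_mem_map hpre
  have hgu : g u = (dualFrame n x).symm (negD n c x y) := by simp only [g, hys]
  rw [hgu] at himg
  have := (dualFrame n x).symm.continuous.continuousAt.preimage_mem_nhds himg
  refine mem_of_superset this ?_
  rintro p ⟨v, hv, hvp⟩
  exact ⟨e.symm v, hv, (dualFrame n x).symm.injective hvp⟩

variable [Nonempty N]

/-- Since `negD n c x` is an embedding, its inverse is continuous on the image, so the extension by
limits changes nothing there. -/
theorem cExp_eq_invFunOn [T2Space N] {c : M → N → ℝ} (ht : TwistFst n c) {x : M}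
    {p : Cotangent n x} (hp : p ∈ expDomain n c x) :
    cExp n c x p = Function.invFunOn (negD n c x) (injLocus n c x) p := by
  refine extendFrom_extends ?_ p hp
  have hemb := (ht x).2.2
  rintro _ ⟨y, hy, rfl⟩
  have hinv := (injOn_negD n ht x).leftInvOn_invFunOn
  intro V hV
  rw [hinv hy] at hV
  have hV' : (Subtype.val ⁻¹' V : Set (injLocus n c x)) ∈ 𝓝 (⟨y, hy⟩ : injLocus n c x) :=
    continuous_subtype_val.continuousAt.preimage_mem_nhds hV
  rw [hemb.isInducing.nhds_eq_comap] at hV'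
  obtain ⟨W, hW, hWV⟩ := hV'
  refine mem_nhdsWithin_iff_exists_mem_nhds_inter.2 ⟨W, hW, ?_⟩
  rintro _ ⟨hyW, y', hy', rfl⟩
  have h : y' ∈ V := hWV (show (⟨y', hy'⟩ : injLocus n c x) ∈ _ from hyW)
  rwa [← hinv hy'] at h

theorem cExp_negD [T2Space N] {c : M → N → ℝ} (ht : TwistFst n c) {x : M} {y : N}
    (hy : y ∈ injLocus n c x) : cExp n c x (negD n c x y) = y := by
  rw [cExp_eq_invFunOn n ht ⟨y, hy, rfl⟩]
  exact (injOn_negD n ht x).leftInvOn_invFunOn hy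

theorem cExp_mem_injLocus [T2Space N] {c : M → N → ℝ} (ht : TwistFst n c) {x : M}
    {p : Cotangent n x} (hp : p ∈ expDomain n c x) : cExp n c x p ∈ injLocus n c x := by
  obtain ⟨y, hy, rfl⟩ := hp
  rwa [cExp_negD n ht hy]

theorem negD_cExp [T2Space N] {c : M → N → ℝ} (ht : TwistFst n c) {x : M}
    {p : Cotangent n x} (hp : p ∈ expDomain n c x) : negD n c x (cExp n c x p) = p := by
  obtain ⟨y, hy, rfl⟩ := hp
  rw [cExp_negD n ht hy]

theorem injOn_cExp [T2Space N] {c : M → N → ℝ} (ht : TwistFst n c) (x : M) :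
    InjOn (cExp n c x) (expDomain n c x) := fun p hp q hq h => by
  rw [← negD_cExp n ht hp, h, negD_cExp n ht hq]

theorem mdifferentiableAt_cExp [IsManifold (𝓡 n) ∞ N] {c : M → N → ℝ} (ht : TwistFst n c)
    (he : CExpExtendsFst n c) {x : M} {p : Cotangent n x} (hp : p ∈ expDomain n c x) :
    MDifferentiableAt 𝓘(ℝ, Cotangent n x) (𝓡 n) (cExp n c x) p :=
  ((he x).1.contMDiffAt (mem_of_superset ((isOpen_expDomain n ht x).mem_nhds hp)
    subset_closure)).mdifferentiableAt (by simp)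

theorem mfderiv_negD_mfderiv_cExp [IsManifold (𝓡 n) ∞ N] [T2Space N] {c : M → N → ℝ}
    (ht : TwistFst n c) (he : CExpExtendsFst n c) {x : M} {p : Cotangent n x}
    (hp : p ∈ expDomain n c x) (q : Cotangent n x) :
    mfderiv (𝓡 n) 𝓘(ℝ, Cotangent n x) (negD n c x) (cExp n c x p)
      (mfderiv 𝓘(ℝ, Cotangent n x) (𝓡 n) (cExp n c x) p
        ((NormedSpace.fromTangentSpace p).symm q)) =
    (NormedSpace.fromTangentSpace (negD n c x (cExp n c x p))).symm q := by
  have h1 := mfderiv_comp p (mdifferentiableAt_negD n ht (cExp_mem_injLocus n ht hp))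
    (mdifferentiableAt_cExp n ht he hp)
  have h2 : negD n c x ∘ cExp n c x =ᶠ[𝓝 p] id := by
    filter_upwards [(isOpen_expDomain n ht x).mem_nhds hp] with q hq
    exact negD_cExp n ht hq
  have h3 : mfderiv 𝓘(ℝ, Cotangent n x) 𝓘(ℝ, Cotangent n x) (negD n c x ∘ cExp n c x) p =
      ContinuousLinearMap.id ℝ (Cotangent n x) := by
    rw [h2.mfderiv_eq]; exact mfderiv_id
  have h4 := congrArg (fun A : Cotangent n x →L[ℝ] Cotangent n x => A q) (h1.symm.trans h3)
  exact h4

/-- The `c`-exponential at `x` in linear coordinates on `T*_x M`. -/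
def coordExp (c : M → N → ℝ) (x : M) (ξ : EuclideanSpace ℝ (Fin n)) : N :=
  cExp n c x (dualFrame n x ξ)

/-- The domain of the `c`-exponential at `x` in linear coordinates on `T*_x M`. -/
def coordDomain (c : M → N → ℝ) (x : M) : Set (EuclideanSpace ℝ (Fin n)) :=
  dualFrame n x ⁻¹' expDomain n c x

theorem mdifferentiableAt_coordExp [IsManifold (𝓡 n) ∞ N] {c : M → N → ℝ} (ht : TwistFst n c)
    (he : CExpExtendsFst n c) {x : M} {ξ : EuclideanSpace ℝ (Fin n)}
    (hξ : ξ ∈ coordDomain n c x) :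
    MDifferentiableAt 𝓘(ℝ, EuclideanSpace ℝ (Fin n)) (𝓡 n) (coordExp n c x) ξ :=
  (mdifferentiableAt_cExp n ht he hξ).comp ξ (mdifferentiableAt_dualFrame n x ξ)

theorem mdifferentiableOn_coordExp {c : M → N → ℝ}
    (he : CExpExtendsFst n c) (x : M) :
    MDifferentiableOn 𝓘(ℝ, EuclideanSpace ℝ (Fin n)) (𝓡 n) (coordExp n c x)
      (dualFrame n x ⁻¹' closure (expDomain n c x)) := fun ξ hξ =>
  ((he x).1.mdifferentiableOn (by simp) _ hξ).comp ξ
    (mdifferentiableAt_dualFrame n x ξ).mdifferentiableWithinAt (mapsTo_preimage _ _)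

theorem mfderiv_coordExp [IsManifold (𝓡 n) ∞ N] {c : M → N → ℝ} (ht : TwistFst n c)
    (he : CExpExtendsFst n c) {x : M} {ξ : EuclideanSpace ℝ (Fin n)}
    (hξ : ξ ∈ coordDomain n c x) (η : EuclideanSpace ℝ (Fin n)) :
    mfderiv 𝓘(ℝ, EuclideanSpace ℝ (Fin n)) (𝓡 n) (coordExp n c x) ξ η =
      mfderiv 𝓘(ℝ, Cotangent n x) (𝓡 n) (cExp n c x) (dualFrame n x ξ)
        ((NormedSpace.fromTangentSpace (dualFrame n x ξ)).symm (dualFrame n x η)) := by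
  have h := mfderiv_comp ξ (mdifferentiableAt_cExp n ht he hξ) (mdifferentiableAt_dualFrame n x ξ)
  rw [(hasMFDerivAt_dualFrame n x ξ).mfderiv] at h
  exact congrArg (fun A : EuclideanSpace ℝ (Fin n) →L[ℝ] EuclideanSpace ℝ (Fin n) => A η) h

variable [RiemannianBundle (fun y : N => TangentSpace (𝓡 n) y)]

theorem jac_coordExp [IsManifold (𝓡 n) ∞ N] {c : M → N → ℝ} (ht : TwistFst n c)
    (he : CExpExtendsFst n c) {x : M} {ξ : EuclideanSpace ℝ (Fin n)}
    (hξ : ξ ∈ coordDomain n c x) :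
    jac n (coordExp n c x) ξ = absDetCExp n c x (dualFrame n x ξ) := by
  unfold jac absDetAt absDetCExp
  congr 2
  ext i j
  have h := mfderiv_coordExp n ht he hξ (EuclideanSpace.single j (1 : ℝ))
  rw [dualFrame_single] at h
  exact congrArg (fun v : TangentSpace (𝓡 n) (coordExp n c x ξ) =>
    inner ℝ (orthoFrame n (coordExp n c x ξ) i) v) h

/-- The two matrices represent, up to a transpose, the mutually inverse differentials of `negD n c
x` and `cExp n c x`. -/
theorem absDetMixed_mul_absDetCExp [IsManifold (𝓡 n) ∞ N] [T2Space N] {c : M → N → ℝ}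
    (ht : TwistFst n c) (he : CExpExtendsFst n c) {x : M} {p : Cotangent n x}
    (hp : p ∈ expDomain n c x) :
    absDetMixed n (flip c) (cExp n c x p) x * absDetCExp n c x p = 1 := by
  rw [absDetMixed, absDetCExp, mul_comm, ← abs_mul]
  set y := cExp n c x p with hy
  set C : Matrix (Fin n) (Fin n) ℝ := Matrix.of fun i j : Fin n =>
    inner ℝ (orthoFrame n y i) (mfderiv 𝓘(ℝ, Cotangent n x) (𝓡 n) (cExp n c x) p
        ((NormedSpace.fromTangentSpace p).symm (innerSL ℝ (orthoFrame n x j)))) with hC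
  rw [← Matrix.det_transpose C, ← Matrix.det_mul]
  refine (congrArg (fun D : Matrix (Fin n) (Fin n) ℝ => |D.det|) 
    (?_ : _ = (1 : Matrix (Fin n) (Fin n) ℝ))).trans (by rw [Matrix.det_one, abs_one])
  ext j i
  rw [Matrix.mul_apply]
  let B : TangentSpace (𝓡 n) y →L[ℝ] Cotangent n x :=
    (NormedSpace.fromTangentSpace (negD n c x y)).toContinuousLinearMap ∘L
      mfderiv (𝓡 n) 𝓘(ℝ, Cotangent n x) (negD n c x) y
  let w : TangentSpace (𝓡 n) y := mfderiv 𝓘(ℝ, Cotangent n x) (𝓡 n) (cExp n c x) p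
        ((NormedSpace.fromTangentSpace p).symm (innerSL ℝ (orthoFrame n x j)))
  have hBw : B w = innerSL ℝ (orthoFrame n x j) := by
    have := mfderiv_negD_mfderiv_cExp n ht he hp (innerSL ℝ (orthoFrame n x j))
    exact congrArg (NormedSpace.fromTangentSpace (negD n c x y)) this
  calc ∑ k, inner ℝ (orthoFrame n y k) w * B (orthoFrame n y k) (orthoFrame n x i)
      = B (∑ k, inner ℝ (orthoFrame n y k) w • orthoFrame n y k) (orthoFrame n x i) := by
        simp
    _ = B w (orthoFrame n x i) := by rw [(orthoFrame n y).sum_repr']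
    _ = (1 : Matrix (Fin n) (Fin n) ℝ) j i := by
        rw [hBw, innerSL_apply_apply, orthonormal_iff_ite.1 (orthoFrame n x).orthonormal,
          Matrix.one_apply]

end Cost

/-! ### Testing a subgradient along a curve. -/

section Subdifferential

variable (n : ℕ) {M : Type*} [TopologicalSpace M] [ChartedSpace (EuclideanSpace ℝ (Fin n)) M]
  [RiemannianBundle (fun x : M => TangentSpace (𝓡 n) x)]

theorem subdiff_apply_le {α : M → ℝ} {x : M} {p : Cotangent n x} (hp : p ∈ subdiff n α x)
    {γ : ℝ → M} (hγ : ContinuousAt γ 0) (hγ0 : γ 0 = x) {a : EuclideanSpace ℝ (Fin n)}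
    (hd : HasDerivAt (fun t => extChartAt (𝓡 n) x (γ t)) a 0) {b : ℝ} {B : ℝ → ℝ}
    (hB : Tendsto B (𝓝[>] 0) (𝓝 b)) (h : ∀ᶠ t in 𝓝[>] 0, α (γ t) - α x ≤ t * B t) :
    p (show TangentSpace (𝓡 n) x from a) ≤ b := by
  set e := extChartAt (𝓡 n) x with he
  let a' : TangentSpace (𝓡 n) x := a
  let v : ℝ → TangentSpace (𝓡 n) x := fun t =>
    (show TangentSpace (𝓡 n) x from (e (γ t) - e x : EuclideanSpace ℝ (Fin n)))
  have hv0 : Tendsto v (𝓝[>] 0) (𝓝 0) := by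
    have h1 : Tendsto (fun t => e (γ t) - e x) (𝓝 0) (𝓝 (e (γ 0) - e x)) :=
      (hd.continuousAt.sub continuousAt_const)
    rw [hγ0, sub_self] at h1
    exact h1.mono_left nhdsWithin_le_nhds
  have hslope : Tendsto (fun t : ℝ => t⁻¹ • v t) (𝓝[>] 0) (𝓝 a') := by
    have h1 := hd.tendsto_slope_zero_right
    simp only [zero_add, hγ0] at h1
    exact h1
  have hsrc : ∀ᶠ t in 𝓝[>] (0 : ℝ), γ t ∈ e.source := by
    refine nhdsWithin_le_nhds (hγ.eventually_mem ?_)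
    rw [hγ0]; exact extChartAt_source_mem_nhds x
  have hε : ∀ ε > (0 : ℝ), p a' - ε * ‖a'‖ ≤ b := by
    intro ε hε
    have hl : Tendsto (fun t : ℝ => p (t⁻¹ • v t) - ε * ‖t⁻¹ • v t‖) (𝓝[>] 0)
        (𝓝 (p a' - ε * ‖a'‖)) :=
      ((p.continuous.tendsto a').comp hslope).sub
        (((continuous_norm.tendsto a').comp hslope).const_mul ε)
    refine le_of_tendsto_of_tendsto hl hB ?_
    filter_upwards [hv0.eventually (hp ε hε), h, hsrc, self_mem_nhdsWithin] with t h1 h2 h3 h4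
    have ht : (0 : ℝ) < t := h4
    have h5 : e.symm (e x + (e (γ t) - e x)) = γ t := by
      rw [add_sub_cancel, e.left_inv h3]
    have h6 : p (v t) - ε * ‖v t‖ ≤ t * B t := by
      refine h1.trans (le_trans (le_of_eq ?_) h2)
      exact congrArg (fun y => α y - α x) h5
    rw [map_smul, norm_smul, smul_eq_mul, norm_inv, Real.norm_eq_abs, abs_of_pos ht]
    have h7 : t⁻¹ * p (v t) - ε * (t⁻¹ * ‖v t‖) = t⁻¹ * (p (v t) - ε * ‖v t‖) := by ring
    rw [h7, inv_mul_le_iff₀ ht]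
    exact h6
  -- The error term of the subgradient is removed only after the limit in `t`, by letting `ε` tend
  -- to zero.
  have hlim : Tendsto (fun ε : ℝ => p a' - ε * ‖a'‖) (𝓝[>] 0) (𝓝 (p a' - 0 * ‖a'‖)) :=
    (tendsto_const_nhds.sub (tendsto_id.mul_const _)).mono_left nhdsWithin_le_nhds
  rw [zero_mul, sub_zero] at hlim
  exact le_of_tendsto hlim (by filter_upwards [self_mem_nhdsWithin] with ε h using hε ε h)

end Subdifferential

/-! ### Convexity in `c`-exponential coordinates and the location of `c`-subgradients. -/

section Cost

variable (n : ℕ) {M N : Type*}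
  [TopologicalSpace M] [ChartedSpace (EuclideanSpace ℝ (Fin n)) M]
  [TopologicalSpace N] [ChartedSpace (EuclideanSpace ℝ (Fin n)) N]

theorem SmoothNear.mdifferentiableAt_snd {c : M → N → ℝ} {x : M} {y : N} (h : SmoothNear n c x y) :
    MDifferentiableAt (𝓡 n) 𝓘(ℝ, ℝ) (fun y' => c x y') y := by
  obtain ⟨U, hU, hc⟩ := h
  have h1 : ContMDiffAt ((𝓡 n).prod (𝓡 n)) 𝓘(ℝ, ℝ) ∞ (Function.uncurry c) (x, y) :=
    hc.contMDiffAt hU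
  have h2 : ContMDiffAt (𝓡 n) ((𝓡 n).prod (𝓡 n)) ∞ (fun y' : N => (x, y')) y :=
    contMDiffAt_const.prodMk contMDiffAt_id
  exact (h1.comp y h2).mdifferentiableAt (by simp)

variable [RiemannianBundle (fun x : M => TangentSpace (𝓡 n) x)]
  [RiemannianBundle (fun y : N => TangentSpace (𝓡 n) y)] [Nonempty M] [Nonempty N]

/-- The cost `-c (·, y)`, renormalized by `c (·, y₀)`, in the coordinates given by the
`c`-exponential at `y₀`. -/
def slidingCost (c : M → N → ℝ) (y₀ y : N) (ξ : EuclideanSpace ℝ (Fin n)) : ℝ :=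
  -c (coordExp n (flip c) y₀ ξ) y + c (coordExp n (flip c) y₀ ξ) y₀

theorem convex_coordDomain {c : N → M → ℝ} (hc : ConvexDomainsFst n c) (y : N) :
    Convex ℝ (coordDomain n c y) :=
  (hc y).linear_preimage (dualFrame n y).toLinearEquiv.toLinearMap

/-- Segments in the coordinate domain are `c`-segments with respect to `y₀`, and DASM along them is
the convexity inequality. -/
theorem convexOn_slidingCost {c : M → N → ℝ} (hc : ConvexDomainsFst n (flip c))
    (hd : ConvexDASMFst n (flip c)) (y₀ y : N) :
    ConvexOn ℝ (coordDomain n (flip c) y₀) (slidingCost n c y₀ y) := by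
  have hU := convex_coordDomain n hc y₀
  refine ⟨hU, fun ξ hξ η hη a b ha hb hab => ?_⟩
  let γ : ℝ → M := fun t => coordExp n (flip c) y₀ ((1 - t) • ξ + t • η)
  have hγ : IsCSegment n (flip c) y₀ γ := by
    refine ⟨dualFrame n y₀ ξ, dualFrame n y₀ η, fun t ht => ?_⟩
    have h1 : (1 - t) • dualFrame n y₀ ξ + t • dualFrame n y₀ η =
        dualFrame n y₀ ((1 - t) • ξ + t • η) := by simp
    rw [h1]
    exact ⟨subset_closure (hU hξ hη (by linarith [ht.2]) ht.1 (by ring)), rfl⟩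
  have h := hd y₀ γ hγ b ⟨hb, by linarith⟩ y
  have ha' : 1 - b = a := by linarith
  simp only [γ, ha', sub_zero, one_smul, zero_smul, add_zero, sub_self, zero_add, flip] at h
  simpa [slidingCost, flip] using h

/-- A `c`-convex function, renormalized by `c (·, y₀)`, is convex in the coordinates given by the
`c`-exponential at `y₀`. -/
theorem CConvex.convexOn {c : M → N → ℝ} (hc : ConvexDomainsFst n (flip c))
    (hd : ConvexDASMFst n (flip c)) {φ : M → ℝ} (hφ : CConvex c φ) (y₀ : N) :
    ConvexOn ℝ (coordDomain n (flip c) y₀) fun ξ =>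
      φ (coordExp n (flip c) y₀ ξ) + c (coordExp n (flip c) y₀ ξ) y₀ := by
  obtain ⟨ψ, hψ, -⟩ := hφ
  refine ⟨convex_coordDomain n hc y₀, fun ξ hξ η hη a b ha hb hab => ?_⟩
  set X := coordExp n (flip c) y₀ with hX
  rw [← le_sub_iff_add_le]
  refine (hψ _).2 ?_
  rintro _ ⟨y, rfl⟩
  have h := (convexOn_slidingCost n hc hd y₀ y).2 hξ hη ha hb hab
  have h1 := (hψ (X ξ)).1 ⟨y, rfl⟩
  have h2 := (hψ (X η)).1 ⟨y, rfl⟩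
  simp only [slidingCost, ← hX, smul_eq_mul] at h h1 h2 ⊢
  have e : ψ y = a * ψ y + b * ψ y := by rw [← add_mul, hab, one_mul]
  nlinarith [mul_le_mul_of_nonneg_left h1 ha, mul_le_mul_of_nonneg_left h2 hb]

variable [IsManifold (𝓡 n) ∞ M]

/-- Subtracting `negD` accounts for the added term `c (·, y₀)`, so the shifted covector, pulled back
by the differential of the coordinates, is a local subgradient of the sliding cost at `z`. For a
convex function it is then a global one. Only `c (·, y₀)` has to be differentiable here, not `c (·,
y)`. -/
theorem subdiff_sub_negD_apply_le [T2Space M] {c : M → N → ℝ} (ht : TwistFst n (flip c))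
    (he : CExpExtendsFst n (flip c)) (hc : ConvexDomainsFst n (flip c))
    (hd : ConvexDASMFst n (flip c)) (y₀ y : N) {z w : EuclideanSpace ℝ (Fin n)}
    (hz : z ∈ coordDomain n (flip c) y₀) (hw : w ∈ coordDomain n (flip c) y₀)
    (p : Cotangent n (coordExp n (flip c) y₀ z))
    (hp : p ∈ subdiff n (fun x' => -c x' y) (coordExp n (flip c) y₀ z)) :
    (p - negD n c (coordExp n (flip c) y₀ z) y₀)
      (mfderiv 𝓘(ℝ, EuclideanSpace ℝ (Fin n)) (𝓡 n) (coordExp n (flip c) y₀) z (w - z)) ≤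
    slidingCost n c y₀ y w - slidingCost n c y₀ y z := by
  revert p
  set X := coordExp n (flip c) y₀ with hX
  intro p hp
  have hXd : MDifferentiableAt 𝓘(ℝ, EuclideanSpace ℝ (Fin n)) (𝓡 n) X z :=
    mdifferentiableAt_coordExp n ht he hz
  have hcd : MDifferentiableAt (𝓡 n) 𝓘(ℝ, ℝ) (fun x' => c x' y₀) (X z) :=
    SmoothNear.mdifferentiableAt_snd n (c := flip c) (cExp_mem_injLocus n ht hz)
  let A : EuclideanSpace ℝ (Fin n) →L[ℝ] EuclideanSpace ℝ (Fin n) :=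
    mfderiv 𝓘(ℝ, EuclideanSpace ℝ (Fin n)) (𝓡 n) X z
  let C : EuclideanSpace ℝ (Fin n) →L[ℝ] ℝ := mfderiv (𝓡 n) 𝓘(ℝ, ℝ) (fun x' => c x' y₀) (X z)
  have hA : HasFDerivAt (fun ξ => extChartAt (𝓡 n) (X z) (X ξ)) A z := by
    have h : HasFDerivWithinAt (fun ξ => extChartAt (𝓡 n) (X z) (X ξ)) A
      (range 𝓘(ℝ, EuclideanSpace ℝ (Fin n))) z := hXd.hasMFDerivAt.2
    rwa [ModelWithCorners.range_eq_univ, hasFDerivWithinAt_univ] at h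
  have hCA : HasFDerivAt (fun ξ => c (X ξ) y₀) (C ∘L A) z :=
    (hcd.hasMFDerivAt.comp z hXd.hasMFDerivAt).hasFDerivAt
  let σ : ℝ → EuclideanSpace ℝ (Fin n) := fun t => z + t • (w - z)
  have hσ0 : σ 0 = z := by simp [σ]
  have hσ : HasDerivAt σ (w - z) 0 := by
    have := ((hasDerivAt_id (0 : ℝ)).smul_const (w - z)).const_add z
    simpa [σ] using this
  have h1 : HasDerivAt (fun t => extChartAt (𝓡 n) (X z) (X (σ t))) (A (w - z)) 0 :=
    HasFDerivAt.comp_hasDerivAt (l := fun ξ => extChartAt (𝓡 n) (X z) (X ξ)) 0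
      (by rwa [hσ0]) hσ
  have h2 : HasDerivAt (fun t => c (X (σ t)) y₀) ((C ∘L A) (w - z)) 0 :=
    HasFDerivAt.comp_hasDerivAt (l := fun ξ => c (X ξ) y₀) 0 (by rwa [hσ0]) hσ
  have hcont : ContinuousAt (fun t => X (σ t)) 0 :=
    ContinuousAt.comp (g := X) (by rw [hσ0]; exact hXd.continuousAt) hσ.continuousAt
  have hB : Tendsto (fun t : ℝ => (slidingCost n c y₀ y w - slidingCost n c y₀ y z) -
      t⁻¹ • (c (X (σ t)) y₀ - c (X z) y₀)) (𝓝[>] 0)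
      (𝓝 ((slidingCost n c y₀ y w - slidingCost n c y₀ y z) - (C ∘L A) (w - z))) := by
    refine tendsto_const_nhds.sub ?_
    have h3 := h2.tendsto_slope_zero_right
    simpa only [zero_add, hσ0] using h3
  -- Convexity on the segment from `z` to `w`, rewritten as an upper bound for the difference
  -- quotient of `-c (·, y)`.
  have hev : ∀ᶠ t in 𝓝[>] (0 : ℝ), -c (X (σ t)) y - -c (X z) y ≤
      t * ((slidingCost n c y₀ y w - slidingCost n c y₀ y z) -
        t⁻¹ • (c (X (σ t)) y₀ - c (X z) y₀)) := by
    filter_upwards [Ioc_mem_nhdsGT (zero_lt_one' ℝ)] with t ht'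
    have h3 := (convexOn_slidingCost n hc hd y₀ y).2 hz hw (sub_nonneg.2 ht'.2) ht'.1.le
      (by ring)
    have h4 : (1 - t) • z + t • w = σ t := by simp only [σ]; module
    rw [h4] at h3
    have h5 : t * (t⁻¹ * (c (X (σ t)) y₀ - c (X z) y₀)) = c (X (σ t)) y₀ - c (X z) y₀ := by
      rw [← mul_assoc, mul_inv_cancel₀ ht'.1.ne', one_mul]
    rw [smul_eq_mul, mul_sub, h5]
    simp only [slidingCost, ← hX, smul_eq_mul] at h3 ⊢
    linarith
  have hfin := subdiff_apply_le n hp hcont (by rw [hσ0]) h1 hB hev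
  let d : TangentSpace (𝓡 n) (X z) :=
    mfderiv 𝓘(ℝ, EuclideanSpace ℝ (Fin n)) (𝓡 n) X z (w - z)
  have h3 : p d ≤ slidingCost n c y₀ y w - slidingCost n c y₀ y z - (C ∘L A) (w - z) := hfin
  have h4 : negD n c (X z) y₀ d = -((C ∘L A) (w - z)) := rfl
  change p d - negD n c (X z) y₀ d ≤ _
  rw [h4]
  linarith

variable [T2Space M]

/-- Halving `K` towards `z` lets subgradients at varying base points be transported to the single
point `z`, at the price of `2h` in place of `h`. -/
theorem cSubdiffImage_subset {c : M → N → ℝ} (ht : TwistFst n (flip c))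
    (he : CExpExtends n c) (hc : ConvexDomainsFst n (flip c))
    (hd : ConvexDASMFst n (flip c)) {φ : M → ℝ} {x₀ : M} {y₀ : N} (hy₀ : y₀ ∈ cSubdiff c φ x₀)
    {h : ℝ} {K : Set (EuclideanSpace ℝ (Fin n))} (hK : K ⊆ coordDomain n (flip c) y₀)
    (hKc : Convex ℝ K)
    (hKh : MapsTo (coordExp n (flip c) y₀) K (cSection c φ x₀ y₀ h))
    {z : EuclideanSpace ℝ (Fin n)} (hz : z ∈ K) :
    cSubdiffImage c φ (coordExp n (flip c) y₀ '' (AffineMap.homothety z (1 / 2 : ℝ) '' K)) ⊆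
      cExp n c (coordExp n (flip c) y₀ z) ''
        (closure (expDomain n c (coordExp n (flip c) y₀ z)) ∩
          {p | ∀ w ∈ K, (p - negD n c (coordExp n (flip c) y₀ z) y₀)
            (mfderiv 𝓘(ℝ, EuclideanSpace ℝ (Fin n)) (𝓡 n) (coordExp n (flip c) y₀) z (w - z)) ≤
              2 * h}) := by
  intro y hy
  simp only [cSubdiffImage, mem_iUnion, exists_prop] at hy
  obtain ⟨_, ⟨q, ⟨w, hw, rfl⟩, rfl⟩, hy⟩ := hy
  set X := coordExp n (flip c) y₀ with hX
  set q := AffineMap.homothety z (1 / 2 : ℝ) w with hq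
  have hq' : q = (1 / 2 : ℝ) • w + (1 / 2 : ℝ) • z := by
    rw [hq, AffineMap.homothety_apply, vsub_eq_sub, vadd_eq_add]; module
  have hqK : q ∈ K := by
    rw [hq']; exact hKc hw hz (by norm_num) (by norm_num) (by norm_num)
  -- The increment is at most that of `φ + c (·, y₀)`, which on the section varies between its
  -- minimum and `h` above it.
  have hsec : ∀ w' ∈ K, slidingCost n c y₀ y w' - slidingCost n c y₀ y q ≤ h := by
    intro w' hw'
    have h1 := hy (X w')
    have h2 := hKh hw'
    have h3 := hy₀ (X q)
    simp only [cSection, mem_ofPred_eq] at h2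
    simp only [slidingCost, ← hX]
    linarith
  -- At the midpoint `q` of `w` and `z`, the value at `w` exceeds that at `q` by at most `h`; hence
  -- the value at `q` exceeds that at `z` by at most `h`.
  have hmid := (convexOn_slidingCost n hc hd y₀ y).2 (hK hw) (hK hz)
    (show (0 : ℝ) ≤ 1 / 2 by norm_num) (show (0 : ℝ) ≤ 1 / 2 by norm_num) (by norm_num)
  rw [← hq'] at hmid
  simp only [smul_eq_mul] at hmid
  have hbound : ∀ w' ∈ K, slidingCost n c y₀ y w' - slidingCost n c y₀ y z ≤ 2 * h := by
    intro w' hw'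
    linarith [hsec w' hw', hsec w hw]
  -- Surjectivity gives some preimage of `y`; the second part of the extension hypothesis exchanges
  -- it for one in the subdifferential.
  obtain ⟨-, hsurj, hsub⟩ := he.1 (X z)
  obtain ⟨p₀, hp₀, hpy⟩ := (hsurj ▸ mem_univ y : y ∈ cExp n c (X z) '' _)
  have h1 := hsub p₀ hp₀
  rw [hpy] at h1
  obtain ⟨p, ⟨hp, hpc⟩, hpy'⟩ := h1
  exact ⟨p, ⟨hpc, fun w' hw' => (subdiff_sub_negD_apply_le n ht he.2 hc hd y₀ y (hK hz) (hK hw')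
    p hp).trans (hbound w' hw')⟩, hpy'⟩

end Cost

/-! ### Volumes of polar bodies under linear maps. -/

section Polar

open scoped Pointwise

variable (n : ℕ) {M : Type*} [TopologicalSpace M] [ChartedSpace (EuclideanSpace ℝ (Fin n)) M]
  [RiemannianBundle (fun x : M => TangentSpace (𝓡 n) x)]

theorem isClosed_polar (x : M) (A : EuclideanSpace ℝ (Fin n) →L[ℝ] TangentSpace (𝓡 n) x)
    (η₀ z : EuclideanSpace ℝ (Fin n)) (K : Set (EuclideanSpace ℝ (Fin n))) (r : ℝ) :
    IsClosed {η | ∀ w ∈ K, dualFrame n x (η - η₀) (A (w - z)) ≤ r} := by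
  simp only [ofPred_forall]
  refine isClosed_iInter fun w => isClosed_iInter fun _ => isClosed_le ?_ continuous_const
  simp only [dualFrame_apply]
  fun_prop

/-- After a translation, the transpose of `A` carries the left set into `r` times the Euclidean
polar body. -/
theorem volume_polar_le (x : M) (A : EuclideanSpace ℝ (Fin n) →L[ℝ] TangentSpace (𝓡 n) x)
    (hA : 0 < absDetAt n x A) (η₀ z : EuclideanSpace ℝ (Fin n))
    (K : Set (EuclideanSpace ℝ (Fin n))) {r : ℝ} (hr : 0 < r) :
    volume {η | ∀ w ∈ K, dualFrame n x (η - η₀) (A (w - z)) ≤ r} ≤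
      (ENNReal.ofReal (absDetAt n x A))⁻¹ * (ENNReal.ofReal r ^ n *
        volume {y : EuclideanSpace ℝ (Fin n) | ∀ w ∈ K, inner ℝ y (w - z) ≤ 1}) := by
  let b := (EuclideanSpace.basisFun (Fin n) ℝ).toBasis
  set C : Matrix (Fin n) (Fin n) ℝ := Matrix.of fun i j : Fin n =>
    inner ℝ (orthoFrame n x i) (A (EuclideanSpace.single j (1 : ℝ))) with hC
  let B : EuclideanSpace ℝ (Fin n) →ₗ[ℝ] EuclideanSpace ℝ (Fin n) := Matrix.toLin b b C.transpose
  have hdet : |LinearMap.det B| = absDetAt n x A := by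
    rw [LinearMap.det_toLin, Matrix.det_transpose]; rfl
  have hB : ∀ η d, dualFrame n x η (A d) = inner ℝ (B η) d := by
    intro η d
    have h1 : A d = ∑ j, d j • A (EuclideanSpace.single j (1 : ℝ)) := by
      conv_lhs => rw [← (EuclideanSpace.basisFun (Fin n) ℝ).sum_repr d]
      simp
    have h2 : ∀ j, B η j = ∑ i, C i j * η i := fun j => by
      have := congrArg (fun v : Fin n → ℝ => v j) (LinearMap.toMatrix_mulVec_repr b b B η)
      simp only [B, LinearMap.toMatrix_toLin] at this
      simpa [Matrix.mulVec, dotProduct, b] using this.symm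
    rw [dualFrame_apply, h1, PiLp.inner_apply]
    simp only [h2, inner_sum, inner_smul_right, Finset.mul_sum, RCLike.inner_apply, conj_trivial]
    rw [Finset.sum_comm]
    refine Finset.sum_congr rfl fun j _ => Finset.sum_congr rfl fun i _ => ?_
    rw [hC, Matrix.of_apply]; ring
  have hsub : {η | ∀ w ∈ K, dualFrame n x (η - η₀) (A (w - z)) ≤ r} ⊆
      (fun η => η + -η₀) ⁻¹' (B ⁻¹' (r • {y : EuclideanSpace ℝ (Fin n) |
        ∀ w ∈ K, inner ℝ y (w - z) ≤ 1})) := by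
    intro η hη
    refine ⟨r⁻¹ • B (η - η₀), fun w hw => ?_, ?_⟩
    · rw [real_inner_smul_left, ← hB, inv_mul_le_iff₀ hr, mul_one]
      exact hη w hw
    · simp only [smul_smul, mul_inv_cancel₀ hr.ne', one_smul, sub_eq_add_neg]
  refine (measure_mono hsub).trans (le_of_eq ?_)
  have hdet0 : LinearMap.det B ≠ 0 := by
    intro h0; rw [h0, abs_zero] at hdet; exact hA.ne hdet
  rw [measure_preimage_add_right, Measure.addHaar_preimage_linearMap _ hdet0,
    Measure.addHaar_smul, abs_inv, hdet, finrank_euclideanSpace_fin, abs_of_pos (pow_pos hr n),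
    ENNReal.ofReal_inv_of_pos hA, ENNReal.ofReal_pow hr.le]

end Polar

/-! ### Volume distortion by the `c`-exponential. -/

section Cost

variable (n : ℕ) {M N : Type*}
  [TopologicalSpace M] [ChartedSpace (EuclideanSpace ℝ (Fin n)) M]
  [TopologicalSpace N] [ChartedSpace (EuclideanSpace ℝ (Fin n)) N]
  [RiemannianBundle (fun x : M => TangentSpace (𝓡 n) x)]
  [RiemannianBundle (fun y : N => TangentSpace (𝓡 n) y)]
  [IsManifold (𝓡 n) ∞ N] [T2Space N] [Nonempty N]

theorem injOn_coordExp {c : M → N → ℝ} (ht : TwistFst n c) (x : M) :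
    InjOn (coordExp n c x) (coordDomain n c x) :=
  (injOn_cExp n ht x).comp (dualFrame n x).injective.injOn (mapsTo_preimage _ _)

theorem absDetMixed_pos {c : M → N → ℝ} (ht : TwistFst n c) (he : CExpExtendsFst n c) {x : M}
    {ξ : EuclideanSpace ℝ (Fin n)} (hξ : ξ ∈ coordDomain n c x) :
    0 < absDetMixed n (flip c) (coordExp n c x ξ) x := by
  refine lt_of_le_of_ne (abs_nonneg _) fun h => ?_
  have := absDetMixed_mul_absDetCExp n ht he hξ
  rw [show cExp n c x (dualFrame n x ξ) = coordExp n c x ξ from rfl, ← h, zero_mul] at this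
  exact zero_ne_one this

theorem jac_coordExp_eq_inv {c : M → N → ℝ} (ht : TwistFst n c) (he : CExpExtendsFst n c) {x : M}
    {ξ : EuclideanSpace ℝ (Fin n)} (hξ : ξ ∈ coordDomain n c x) :
    jac n (coordExp n c x) ξ = (absDetMixed n (flip c) (coordExp n c x ξ) x)⁻¹ := by
  rw [jac_coordExp n ht he hξ]
  exact (eq_inv_of_mul_eq_one_right (absDetMixed_mul_absDetCExp n ht he hξ))

theorem ofReal_jac_coordExp {c : M → N → ℝ} (ht : TwistFst n c) (he : CExpExtendsFst n c) {x : M}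
    {ξ : EuclideanSpace ℝ (Fin n)} (hξ : ξ ∈ coordDomain n c x) :
    ENNReal.ofReal (jac n (coordExp n c x) ξ) =
      (ENNReal.ofReal (absDetMixed n (flip c) (coordExp n c x ξ) x))⁻¹ := by
  rw [jac_coordExp_eq_inv n ht he hξ, ENNReal.ofReal_inv_of_pos (absDetMixed_pos n ht he hξ)]

theorem image_coordExp_coordDomain {c : M → N → ℝ} (ht : TwistFst n c) (x : M) :
    coordExp n c x '' coordDomain n c x = injLocus n c x := by
  ext y
  constructor
  · rintro ⟨ξ, hξ, rfl⟩
    exact cExp_mem_injLocus n ht hξ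
  · intro hy
    refine ⟨(dualFrame n x).symm (negD n c x y), ?_, ?_⟩
    · exact ⟨y, hy, by simp⟩
    · simp [coordExp, cExp_negD n ht hy]

variable [SecondCountableTopology N] [MeasurableSpace N] [BorelSpace N]

/-- The boundary of the convex domain is null, and the smooth extension keeps its image null, so
Jacobians inside the open domain suffice. -/
theorem riemVol_cExp_image_le {c : M → N → ℝ} (ht : TwistFst n c) (he : CExpExtendsFst n c)
    (hc : ConvexDomainsFst n c) (x : M) {S : Set (Cotangent n x)}
    (hS : MeasurableSet (dualFrame n x ⁻¹' S)) :
    riemVol n (cExp n c x '' (closure (expDomain n c x) ∩ S)) ≤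
      (⨆ p ∈ expDomain n c x, ENNReal.ofReal (absDetCExp n c x p)) *
        volume (dualFrame n x ⁻¹' S) := by
  set U := coordDomain n c x with hU
  have hUo : IsOpen U := (isOpen_expDomain n ht x).preimage (dualFrame n x).continuous
  have hUc : Convex ℝ U := (hc x).linear_preimage (dualFrame n x).toLinearEquiv.toLinearMap
  have hcl : dualFrame n x ⁻¹' closure (expDomain n c x) = closure U :=
    (dualFrame n x).toHomeomorph.preimage_closure _
  have hsub : cExp n c x '' (closure (expDomain n c x) ∩ S) ⊆
      coordExp n c x '' (U ∩ dualFrame n x ⁻¹' S) ∪ coordExp n c x '' frontier U := by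
    rintro _ ⟨p, ⟨hp, hpS⟩, rfl⟩
    obtain ⟨ξ, rfl⟩ := (dualFrame n x).surjective p
    have hξ : ξ ∈ closure U := hcl ▸ hp
    by_cases h : ξ ∈ U
    · exact Or.inl ⟨ξ, ⟨h, hpS⟩, rfl⟩
    · exact Or.inr ⟨ξ, ⟨hξ, by rwa [hUo.interior_eq]⟩, rfl⟩
  refine (measure_mono hsub).trans ((measure_union_le _ _).trans ?_)
  have h0 : riemVol n (coordExp n c x '' frontier U) = 0 := by
    refine riemVol_image_eq_zero n (hUc.addHaar_frontier volume) ?_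
    refine (mdifferentiableOn_coordExp n he x).mono ?_
    rw [hcl]; exact frontier_subset_closure
  have hm : MeasurableSet (U ∩ dualFrame n x ⁻¹' S) := hUo.measurableSet.inter hS
  rw [h0, add_zero, riemVol_image n hm (fun u hu => mdifferentiableAt_coordExp n ht he hu.1)
    ((injOn_coordExp n ht x).mono inter_subset_left)]
  calc ∫⁻ u in U ∩ dualFrame n x ⁻¹' S, ENNReal.ofReal (jac n (coordExp n c x) u)
      ≤ ∫⁻ _ in U ∩ dualFrame n x ⁻¹' S,
        ⨆ p ∈ expDomain n c x, ENNReal.ofReal (absDetCExp n c x p) := by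
        refine setLIntegral_mono' hm fun u hu => ?_
        rw [jac_coordExp n ht he hu.1]
        exact le_iSup₂ (f := fun p (_ : p ∈ expDomain n c x) =>
          ENNReal.ofReal (absDetCExp n c x p)) (dualFrame n x u) hu.1
    _ = (⨆ p ∈ expDomain n c x, ENNReal.ofReal (absDetCExp n c x p)) *
        volume (U ∩ dualFrame n x ⁻¹' S) := setLIntegral_const _ _
    _ ≤ _ := by gcongr; exact inter_subset_right

/-- Volume of the image of a convex set of covectors. -/
theorem riemVol_coordExp_image_le {c : M → N → ℝ} (ht : TwistFst n c) (he : CExpExtendsFst n c)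
    (x : M) {Z : Set (EuclideanSpace ℝ (Fin n))} (hZ : Convex ℝ Z) (hZU : Z ⊆ coordDomain n c x) :
    riemVol n (coordExp n c x '' Z) ≤
      (⨅ y ∈ coordExp n c x '' Z, ENNReal.ofReal (absDetMixed n (flip c) y x))⁻¹ * volume Z := by
  have hsub : coordExp n c x '' Z ⊆
      coordExp n c x '' interior Z ∪ coordExp n c x '' (frontier Z ∩ Z) := by
    rw [← image_union]
    refine image_mono fun ξ hξ => ?_
    by_cases h : ξ ∈ interior Z
    · exact Or.inl h
    · exact Or.inr ⟨⟨subset_closure hξ, h⟩, hξ⟩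
  refine (measure_mono hsub).trans ((measure_union_le _ _).trans ?_)
  have hd : ∀ ξ ∈ Z, MDifferentiableAt 𝓘(ℝ, EuclideanSpace ℝ (Fin n)) (𝓡 n) (coordExp n c x) ξ :=
    fun ξ hξ => mdifferentiableAt_coordExp n ht he (hZU hξ)
  have h0 : riemVol n (coordExp n c x '' (frontier Z ∩ Z)) = 0 :=
    riemVol_image_eq_zero n (measure_mono_null inter_subset_left (hZ.addHaar_frontier volume))
      fun ξ hξ => (hd ξ hξ.2).mdifferentiableWithinAt
  have hint : interior Z ⊆ Z := interior_subset
  rw [h0, add_zero, riemVol_image n isOpen_interior.measurableSet (fun ξ hξ => hd ξ (hint hξ))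
    ((injOn_coordExp n ht x).mono (hint.trans hZU))]
  calc ∫⁻ ξ in interior Z, ENNReal.ofReal (jac n (coordExp n c x) ξ)
      ≤ ∫⁻ _ in interior Z,
        (⨅ y ∈ coordExp n c x '' Z, ENNReal.ofReal (absDetMixed n (flip c) y x))⁻¹ := by
        refine setLIntegral_mono' isOpen_interior.measurableSet fun ξ hξ => ?_
        rw [ofReal_jac_coordExp n ht he (hZU (hint hξ)), ENNReal.inv_le_inv]
        exact iInf₂_le (f := fun y (_ : y ∈ coordExp n c x '' Z) =>
          ENNReal.ofReal (absDetMixed n (flip c) y x)) _ ⟨ξ, hint hξ, rfl⟩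
    _ = _ * volume (interior Z) := setLIntegral_const _ _
    _ ≤ _ := by gcongr

theorem volume_le_mul_riemVol_coordExp_image {c : M → N → ℝ} (ht : TwistFst n c)
    (he : CExpExtendsFst n c) (x : M) {K : Set (EuclideanSpace ℝ (Fin n))} (hK : MeasurableSet K)
    (hKU : K ⊆ coordDomain n c x) {S : ℝ≥0∞} (hS : S ≠ ⊤)
    (hle : ∀ ξ ∈ K, ENNReal.ofReal (absDetMixed n (flip c) (coordExp n c x ξ) x) ≤ S) :
    volume K ≤ S * riemVol n (coordExp n c x '' K) := by
  rcases K.eq_empty_or_nonempty with rfl | ⟨ξ₀, hξ₀⟩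
  · simp
  have hS0 : S ≠ 0 := by
    refine ((ENNReal.ofReal_pos.2 (absDetMixed_pos n ht he (hKU hξ₀))).trans_le (hle ξ₀ hξ₀)).ne'
  rw [riemVol_image n hK (fun ξ hξ => mdifferentiableAt_coordExp n ht he (hKU hξ))
    ((injOn_coordExp n ht x).mono hKU)]
  calc volume K = S * (S⁻¹ * volume K) := by
        rw [← mul_assoc, ENNReal.mul_inv_cancel hS0 hS, one_mul]
    _ = S * ∫⁻ _ in K, S⁻¹ := by rw [setLIntegral_const]
    _ ≤ _ := by
        gcongr 1
        refine setLIntegral_mono' hK fun ξ hξ => ?_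
        rw [ofReal_jac_coordExp n ht he (hKU hξ), ENNReal.inv_le_inv]
        exact hle ξ hξ

end Cost

/-! ### Exhaustion of convex sets by compact convex ones. -/

theorem exists_finite_subset_convexHull {E : Type*} [NormedAddCommGroup E] [NormedSpace ℝ E]
    [FiniteDimensional ℝ E] {O K : Set E} (hO : IsOpen O) (hKO : K ⊆ O) (hK : IsCompact K) :
    ∃ t : Set E, t.Finite ∧ K ⊆ convexHull ℝ t ∧ t ⊆ O := by
  have hex : ∀ x ∈ K, ∃ b : Set E, b.Finite ∧ x ∈ interior (convexHull ℝ b) ∧ b ⊆ O := by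
    intro x hx
    obtain ⟨b, hb, hbO⟩ := exists_mem_interior_convexHull_affineBasis (hO.mem_nhds (hKO hx))
    exact ⟨range b, finite_range b, hb, (subset_convexHull ℝ _).trans hbO⟩
  choose! b hbf hb hbO using hex
  obtain ⟨s, hs, hcov⟩ := hK.elim_nhds_subcover (fun x => convexHull ℝ (b x))
    fun x hx => mem_interior_iff_mem_nhds.1 (hb x hx)
  refine ⟨⋃ x ∈ s, b x, s.finite_toSet.biUnion fun x hx => hbf x (hs x hx), ?_, ?_⟩
  · refine hcov.trans (iUnion₂_subset fun x hx => ?_)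
    exact convexHull_mono (subset_biUnion_of_mem (u := fun x => b x) hx)
  · exact iUnion₂_subset fun x hx => hbO x (hs x hx)

/-- An inequality for the squared volume of the compact convex subsets of a convex set extends to
the set itself. -/
theorem mul_volume_sq_le_of_forall_compact {n : ℕ} {Z : Set (EuclideanSpace ℝ (Fin n))}
    (hZ : Convex ℝ Z) {a C : ℝ≥0∞} (ha : a ≠ 0) (ha' : a ≠ ⊤)
    (h : ∀ K ⊆ Z, IsCompact K → Convex ℝ K → K.Nonempty → a * volume K ^ 2 ≤ C) :
    a * volume Z ^ 2 ≤ C := by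
  -- Solving for the volume turns the claim into an upper bound that passes to suprema, here over
  -- the compact subsets of the interior.
  have hiff : ∀ v : ℝ≥0∞, a * v ^ 2 ≤ C ↔ v ≤ (C / a) ^ ((2 : ℝ)⁻¹) := fun v => by
    rw [ENNReal.le_rpow_inv_iff (by norm_num), ENNReal.le_div_iff_mul_le (Or.inl ha) (Or.inl ha'),
      mul_comm, ENNReal.rpow_ofNat]
  rw [hiff]
  have h1 : volume Z ≤ volume (interior Z) := by
    have : Z ⊆ interior Z ∪ frontier Z := fun x hx => by
      by_cases h : x ∈ interior Z
      · exact Or.inl h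
      · exact Or.inr ⟨subset_closure hx, h⟩
    refine (measure_mono this).trans ((measure_union_le _ _).trans ?_)
    rw [hZ.addHaar_frontier volume, add_zero]
  refine h1.trans ?_
  rw [isOpen_interior.measure_eq_iSup_isCompact]
  refine iSup₂_le fun K hK => iSup_le fun hKc => ?_
  rcases K.eq_empty_or_nonempty with rfl | hne
  · simp
  obtain ⟨t, ht, hKt, htZ⟩ := exists_finite_subset_convexHull isOpen_interior hK hKc
  refine (measure_mono hKt).trans ?_
  rw [← hiff]
  exact h _ (convexHull_min (htZ.trans interior_subset) hZ) (ht.isCompact_convexHull ℝ)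
    (convex_convexHull ℝ t) (hne.mono hKt)

/-! ### The volume estimate for the section. -/

section Final

variable {n : ℕ} {M N : Type*}
    [TopologicalSpace M] [T2Space M] [SecondCountableTopology M]
    [ChartedSpace (EuclideanSpace ℝ (Fin n)) M] [IsManifold (𝓡 n) ∞ M]
    [RiemannianBundle (fun x : M => TangentSpace (𝓡 n) x)]
    [MeasurableSpace M] [BorelSpace M] [Nonempty M]
    [TopologicalSpace N] [T2Space N] [SecondCountableTopology N]
    [ChartedSpace (EuclideanSpace ℝ (Fin n)) N] [IsManifold (𝓡 n) ∞ N]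
    [RiemannianBundle (fun y : N => TangentSpace (𝓡 n) y)]
    [MeasurableSpace N] [BorelSpace N] [Nonempty N]

/-- The estimate for the volume of a compact convex part of a `c`-section, seen in the coordinates
given by the `c`-exponential at `y₀`. -/
theorem mul_volume_sq_le_of_subset_cSection {c : M → N → ℝ}
    (ht : Twist n c) (he : CExpExtends n c) (hc : ConvexDomains n c) (hd : ConvexDASM n c)
    {φ : M → ℝ} {lam : ℝ≥0∞}
    (hMA : ∀ Ω : Set M, MeasurableSet Ω →
      lam * riemVol n Ω ≤ riemVol n (cSubdiffImage c φ Ω))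
    {x₀ : M} {y₀ : N} (hy₀ : y₀ ∈ cSubdiff c φ x₀) {h : ℝ} (hh : 0 < h) {S D : ℝ≥0∞} (hS : S ≠ ⊤)
    (hSle : ∀ x ∈ cSection c φ x₀ y₀ h, ENNReal.ofReal (absDetMixed n c x y₀) ≤ S)
    (hDle : ∀ x ∈ cSection c φ x₀ y₀ h,
      (⨆ p ∈ expDomain n c x, ENNReal.ofReal (absDetCExp n c x p)) ≤ D)
    {K : Set (EuclideanSpace ℝ (Fin n))} (hK : IsCompact K) (hKc : Convex ℝ K) (hne : K.Nonempty)
    (hKU : K ⊆ coordDomain n (flip c) y₀)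
    (hKh : MapsTo (coordExp n (flip c) y₀) K (cSection c φ x₀ y₀ h)) :
    lam * volume K ^ 2 ≤ (4 * (n : ℝ≥0∞)) ^ n *
      volume (Metric.ball (0 : EuclideanSpace ℝ (Fin n)) 1) ^ 2 * S ^ 2 * D *
        ENNReal.ofReal h ^ n := by
  obtain ⟨z, hz, hpolar⟩ := exists_volume_mul_volume_polar_le_euclidean hK hKc hne
  set P := volume {y : EuclideanSpace ℝ (Fin n) | ∀ w ∈ K, inner ℝ y (w - z) ≤ 1} with hP
  set β := volume (Metric.ball (0 : EuclideanSpace ℝ (Fin n)) 1) with hβ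
  set X := coordExp n (flip c) y₀ with hX
  set K' := AffineMap.homothety z (1 / 2 : ℝ) '' K with hK'
  have hK'K : K' ⊆ K := by
    rintro _ ⟨w, hw, rfl⟩
    have : AffineMap.homothety z (1 / 2 : ℝ) w = (1 / 2 : ℝ) • w + (1 / 2 : ℝ) • z := by
      rw [AffineMap.homothety_apply, vsub_eq_sub, vadd_eq_add]; module
    rw [this]
    exact hKc hw hz (by norm_num) (by norm_num) (by norm_num)
  have hK'm : MeasurableSet K' :=
    (hK.image (AffineMap.homothety_continuous z _)).measurableSet
  have hvolK : volume K = 2 ^ n * volume K' := by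
    rw [hK', Measure.addHaar_image_homothety, finrank_euclideanSpace_fin, abs_of_pos (by positivity),
      ← mul_assoc, ENNReal.ofReal_pow (by positivity), ← mul_pow]
    have : (2 : ℝ≥0∞) * ENNReal.ofReal (1 / 2) = 1 := by
      rw [show (2 : ℝ≥0∞) = ENNReal.ofReal 2 by simp, ← ENNReal.ofReal_mul (by norm_num)]
      norm_num
    rw [this, one_pow, one_mul]
  have hΩm : MeasurableSet (X '' K') :=
    measurableSet_image n hK'm
      (fun ξ hξ => mdifferentiableAt_coordExp n ht.2 he.2 (hKU (hK'K hξ)))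
      ((injOn_coordExp n ht.2 y₀).mono (hK'K.trans hKU))
  have hlower : volume K' ≤ S * riemVol n (X '' K') :=
    volume_le_mul_riemVol_coordExp_image n ht.2 he.2 y₀ hK'm (hK'K.trans hKU) hS
      fun ξ hξ => hSle _ (hKh (hK'K hξ))
  have hmass : riemVol n (cSubdiffImage c φ (X '' K')) ≤
      D * (S * (ENNReal.ofReal (2 * h) ^ n * P)) := by
    let A : EuclideanSpace ℝ (Fin n) →L[ℝ] TangentSpace (𝓡 n) (X z) :=
      mfderiv 𝓘(ℝ, EuclideanSpace ℝ (Fin n)) (𝓡 n) X z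
    set η₀ := (dualFrame n (X z)).symm (negD n c (X z) y₀) with hη₀
    set Q : Set (Cotangent n (X z)) := {p | ∀ w ∈ K,
      (p - negD n c (X z) y₀) (A (w - z)) ≤ 2 * h} with hQ
    have hpre : dualFrame n (X z) ⁻¹' Q =
        {η | ∀ w ∈ K, dualFrame n (X z) (η - η₀) (A (w - z)) ≤ 2 * h} := by
      ext η
      simp only [hQ, mem_preimage, mem_ofPred_eq, map_sub, hη₀, ContinuousLinearEquiv.apply_symm_apply]
    have hsub := cSubdiffImage_subset n ht.2 he hc.2 hd.2 hy₀ hKU hKc hKh hz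
    have hjac : absDetAt n (X z) A = (absDetMixed n c (X z) y₀)⁻¹ :=
      jac_coordExp_eq_inv n ht.2 he.2 (hKU hz)
    have hpos : 0 < absDetMixed n c (X z) y₀ := absDetMixed_pos n ht.2 he.2 (hKU hz)
    have hvol := volume_polar_le n (X z) A (by rw [hjac]; exact inv_pos.2 hpos) η₀ z K
      (show 0 < 2 * h by positivity)
    rw [hjac, ENNReal.ofReal_inv_of_pos hpos, inv_inv] at hvol
    have hQm : MeasurableSet (dualFrame n (X z) ⁻¹' Q) := by
      rw [hpre]; exact (isClosed_polar n (X z) A η₀ z K _).measurableSet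
    calc riemVol n (cSubdiffImage c φ (X '' K'))
        ≤ riemVol n (cExp n c (X z) '' (closure (expDomain n c (X z)) ∩ Q)) := measure_mono hsub
      _ ≤ (⨆ p ∈ expDomain n c (X z), ENNReal.ofReal (absDetCExp n c (X z) p)) *
          volume (dualFrame n (X z) ⁻¹' Q) :=
          riemVol_cExp_image_le n ht.1 he.1 hc.1 (X z) hQm
      _ ≤ D * (S * (ENNReal.ofReal (2 * h) ^ n * P)) := by
          refine mul_le_mul' (hDle _ (hKh hz)) ?_
          rw [hpre]
          exact hvol.trans (mul_le_mul_left (hSle _ (hKh hz)) _)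
  -- Only one factor `volume K` is passed on to `K'`; the other is kept to be paired with the polar
  -- volume `P`. One `2 ^ n` comes from the halving, the other from the height `2 * h`.
  calc lam * volume K ^ 2 = lam * (volume K * (2 ^ n * volume K')) := by rw [← hvolK, sq]
    _ ≤ lam * (volume K * (2 ^ n * (S * riemVol n (X '' K')))) := by gcongr
    _ = 2 ^ n * volume K * S * (lam * riemVol n (X '' K')) := by ring
    _ ≤ 2 ^ n * volume K * S * (D * (S * (ENNReal.ofReal (2 * h) ^ n * P))) := by
        exact mul_le_mul' le_rfl ((hMA _ hΩm).trans hmass)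
    _ = (4 * ENNReal.ofReal h) ^ n * S ^ 2 * D * (volume K * P) := by
        rw [ENNReal.ofReal_mul (by norm_num), ENNReal.ofReal_ofNat, mul_pow 2,
          show (4 : ℝ≥0∞) = 2 * 2 by norm_num, mul_pow (2 * 2), mul_pow 2 2]
        ring
    _ ≤ (4 * ENNReal.ofReal h) ^ n * S ^ 2 * D * ((n : ℝ≥0∞) ^ n * β ^ 2) := by gcongr
    _ = _ := by rw [mul_pow, mul_pow]; ring

end Final

end OT

end

theorem lemma4p1 {n : ℕ} {M N : Type*}
    [EMetricSpace M] [SecondCountableTopology M] [CompleteSpace M]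
    [ChartedSpace (EuclideanSpace ℝ (Fin n)) M] [IsManifold (𝓡 n) ∞ M]
    [RiemannianBundle (fun x : M => TangentSpace (𝓡 n) x)]
    [IsContMDiffRiemannianBundle (𝓡 n) ∞ (EuclideanSpace ℝ (Fin n))
      (fun x : M => TangentSpace (𝓡 n) x)]
    [IsRiemannianManifold (𝓡 n) M] [MeasurableSpace M] [BorelSpace M] [Nonempty M]
    [EMetricSpace N] [SecondCountableTopology N] [CompleteSpace N]
    [ChartedSpace (EuclideanSpace ℝ (Fin n)) N] [IsManifold (𝓡 n) ∞ N]
    [RiemannianBundle (fun y : N => TangentSpace (𝓡 n) y)]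
    [IsContMDiffRiemannianBundle (𝓡 n) ∞ (EuclideanSpace ℝ (Fin n))
      (fun y : N => TangentSpace (𝓡 n) y)]
    [IsRiemannianManifold (𝓡 n) N] [MeasurableSpace N] [BorelSpace N] [Nonempty N]
    (c : M → N → ℝ) (hsc : OT.Semiconcave n c)
    (htwist : OT.Twist n c) (hexp : OT.CExpExtends n c)
    (hconv : OT.ConvexDomains n c) (hdasm : OT.ConvexDASM n c)
    (φ : M → ℝ) (hφ : OT.CConvex c φ) (lam : ℝ) (hlam : 0 < lam)
    (hMA : ∀ Ω : Set M, MeasurableSet Ω →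
      ENNReal.ofReal lam * OT.riemVol n Ω ≤ OT.riemVol n (OT.cSubdiffImage c φ Ω))
    (x₀ : M) (y₀ : N) (hy₀ : y₀ ∈ OT.cSubdiff c φ x₀) (h : ℝ) (hh : 0 < h)
    (hZ : OT.cSection c φ x₀ y₀ h ⊆ OT.injLocus n (flip c) y₀) :
    ENNReal.ofReal lam * OT.riemVol n (OT.cSection c φ x₀ y₀ h) ^ 2 ≤
      (4 * (n : ℝ≥0∞)) ^ n * volume (Metric.ball (0 : EuclideanSpace ℝ (Fin n)) 1) ^ 2 *
        ((⨆ x ∈ OT.cSection c φ x₀ y₀ h, ENNReal.ofReal (OT.absDetMixed n c x y₀)) /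
          (⨅ x ∈ OT.cSection c φ x₀ y₀ h, ENNReal.ofReal (OT.absDetMixed n c x y₀))) ^ 2 *
        (⨆ x ∈ OT.cSection c φ x₀ y₀ h, ⨆ p ∈ OT.expDomain n c x,
          ENNReal.ofReal (OT.absDetCExp n c x p)) *
        ENNReal.ofReal h ^ n := by
  set Z := OT.cSection c φ x₀ y₀ h with hZdef
  set S := ⨆ x ∈ Z, ENNReal.ofReal (OT.absDetMixed n c x y₀) with hS
  set I := ⨅ x ∈ Z, ENNReal.ofReal (OT.absDetMixed n c x y₀) with hI
  set D := ⨆ x ∈ Z, ⨆ p ∈ OT.expDomain n c x, ENNReal.ofReal (OT.absDetCExp n c x p) with hD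
  set β := volume (Metric.ball (0 : EuclideanSpace ℝ (Fin n)) 1) with hβ
  set U := OT.coordDomain n (flip c) y₀ with hU
  set X := OT.coordExp n (flip c) y₀ with hX
  have hSle : ∀ x ∈ Z, ENNReal.ofReal (OT.absDetMixed n c x y₀) ≤ S := fun x hx =>
    le_iSup₂ (f := fun x (_ : x ∈ Z) => ENNReal.ofReal (OT.absDetMixed n c x y₀)) x hx
  have hDle : ∀ x ∈ Z, (⨆ p ∈ OT.expDomain n c x, ENNReal.ofReal (OT.absDetCExp n c x p)) ≤ D :=
    fun x hx => le_iSup₂ (f := fun x (_ : x ∈ Z) =>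
      ⨆ p ∈ OT.expDomain n c x, ENNReal.ofReal (OT.absDetCExp n c x p)) x hx
  rcases eq_or_ne S ⊤ with hStop | hStop
  -- If the supremum is infinite, so is the right side. This needs every other factor to be nonzero
  -- and the infimum to be finite, both read off at `x₀`.
  · have hx₀ : x₀ ∈ Z := by simp [hZdef, OT.cSection, hh.le]
    have hItop : I ≠ ⊤ := ((iInf₂_le (f := fun x (_ : x ∈ Z) =>
      ENNReal.ofReal (OT.absDetMixed n c x y₀)) x₀ hx₀).trans_lt ENNReal.ofReal_lt_top).ne
    have hD0 : D ≠ 0 := by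
      obtain ⟨p, hp⟩ : (OT.expDomain n c x₀).Nonempty := by
        rw [← closure_nonempty_iff, ← image_nonempty (f := OT.cExp n c x₀), (hexp.1 x₀).2.1]
        exact univ_nonempty
      have h1 := OT.absDetMixed_mul_absDetCExp n htwist.1 hexp.1 hp
      have h2 : 0 < OT.absDetCExp n c x₀ p := by
        refine lt_of_le_of_ne (abs_nonneg _) fun h0 => ?_
        rw [← h0, mul_zero] at h1
        exact zero_ne_one h1
      have h3 := (le_iSup₂ (f := fun p (_ : p ∈ OT.expDomain n c x₀) =>
        ENNReal.ofReal (OT.absDetCExp n c x₀ p)) p hp).trans (hDle x₀ hx₀)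
      exact ((ENNReal.ofReal_pos.2 h2).trans_le h3).ne'
    have hβ0 : β ≠ 0 := (Metric.measure_ball_pos volume _ one_pos).ne'
    have hn0 : (4 * (n : ℝ≥0∞)) ^ n ≠ 0 := by
      rcases Nat.eq_zero_or_pos n with h0 | h0
      · simp [h0]
      · exact pow_ne_zero _ (mul_ne_zero (by norm_num) (by exact_mod_cast h0.ne'))
    have hh0 : ENNReal.ofReal h ^ n ≠ 0 := pow_ne_zero _ (ENNReal.ofReal_pos.2 hh).ne'
    refine le_of_le_of_eq le_top (Eq.symm ?_)
    rw [hStop, ENNReal.top_div_of_ne_top hItop, ENNReal.top_pow (by norm_num),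
      ENNReal.mul_top (mul_ne_zero hn0 (pow_ne_zero _ hβ0)), ENNReal.top_mul hD0,
      ENNReal.top_mul hh0]
  set W := U ∩ X ⁻¹' Z with hW
  have hWU : W ⊆ U := inter_subset_left
  -- In these coordinates the section is a sublevel set of the convex function `φ + c (·, y₀)`.
  have hWc : Convex ℝ W := by
    convert! (OT.CConvex.convexOn n hconv.2 hdasm.2 hφ y₀).convex_le (φ x₀ + c x₀ y₀ + h) using 1
    ext ξ
    simp only [hW, hZdef, OT.cSection, mem_inter_iff, mem_preimage, mem_ofPred_eq]
    refine and_congr_right fun _ => ?_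
    constructor <;> intro h1 <;> linarith
  -- The section is assumed to avoid the cut locus of `y₀`, so the coordinates cover all of it.
  have hXW : X '' W = Z := by
    rw [hW, image_inter_preimage, OT.image_coordExp_coordDomain n htwist.2 y₀,
      inter_eq_right]
    exact hZ
  have hvolW : ENNReal.ofReal lam * volume W ^ 2 ≤
      (4 * (n : ℝ≥0∞)) ^ n * β ^ 2 * S ^ 2 * D * ENNReal.ofReal h ^ n :=
    OT.mul_volume_sq_le_of_forall_compact hWc (ENNReal.ofReal_pos.2 hlam).ne' ENNReal.ofReal_ne_top
      fun K hKW hK hKc hne => OT.mul_volume_sq_le_of_subset_cSection htwist hexp hconv hdasm hMA hy₀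
        hh hStop hSle hDle hK hKc hne (hKW.trans hWU) fun ξ hξ => (hKW hξ).2
  have hvolZ : OT.riemVol n Z ≤ I⁻¹ * volume W := by
    have h1 := OT.riemVol_coordExp_image_le n htwist.2 hexp.2 y₀ hWc hWU
    rw [← hX, hXW] at h1
    exact h1
  calc ENNReal.ofReal lam * OT.riemVol n Z ^ 2
      ≤ ENNReal.ofReal lam * (I⁻¹ * volume W) ^ 2 := by gcongr
    _ = I⁻¹ ^ 2 * (ENNReal.ofReal lam * volume W ^ 2) := by ring
    _ ≤ I⁻¹ ^ 2 * ((4 * (n : ℝ≥0∞)) ^ n * β ^ 2 * S ^ 2 * D * ENNReal.ofReal h ^ n) := by gcongr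
    _ = _ := by rw [div_eq_mul_inv]; ring
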